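/- **Sequences.** For a word $S=(a_1,\dots,a_n)$ over $\{+1,-1\}$ put $\overline S=(-a_n,\dots,-a_1)$. The only $0$-folding sequence is the empty word, and the $(n+1)$-folding sequences are the words $(\overline S,\zeta,S)$ with $S$ an $n$-folding sequence and $\zeta\in\{+1,-1\}$ (the sequences of folds obtained by folding a strip of paper $n+1$ times in two). A *complete folding sequence* is a sequence $a=(a_k)_{k\in\mathbb Z}\subset\{+1,-1\}$ each of whose finite subwords (blocks of consecutive terms) is a subword of some $n$-folding sequence. Two sequences indexed by $\mathbb Z$ are *locally isomorphic* if they have the same finite subwords. For a complete folding sequence $a$ there is $h\in\mathbb Z$ with $a_{h+4k}=(-1)^k a_h$ for all $k\in\mathbb Z$, and $E_1(a)=h+2\mathbb Z$ does not depend on the choice of $h$. **Segments and tiles.** Fix $0<\alpha<1/4$. For $x,y\in\mathbb Z$ and $\zeta,\eta\in\{+1,-1\}$ let $C_H(x,y,\zeta,\eta)$ be the broken line through $(x+\alpha,y+\zeta\alpha)$, $(x+2\alpha,y)$, $(x+1-2\alpha,y)$, $(x+1-\alpha,y+\eta\alpha)$; its *support* is $[(x,y),(x+1,y)]$. Let $C_V(x,y,\zeta,\eta)$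 be the broken line through $(x+\zeta\alpha,y+\alpha)$, $(x,y+2\alpha)$, $(x,y+1-2\alpha)$, $(x+\eta\alpha,y+1-\alpha)$, with support $[(x,y),(x,y+1)]$. A *segment* is one of these broken lines with one of its two orientations; its *endpoints* are those of its support. The *tile* of a segment is the closed square having the support as a diagonal, together with the closed square of side $2\alpha$ (sides parallel to the axes) centered at the end of the oriented broken line, minus the open square of side $2\alpha$ (sides parallel to the axes) centered at its beginning. Segments $A,B$ are *consecutive* if they have exactly one common point and the end of $A$ is the beginning of $B$. **Curves.** A *complete curve* is a sequence $C=(C_i)_{i\in\mathbb Z}$ of segments with pairwise distinct supports such that $C_i,C_{i+1}$ are consecutive for every $i$. Its *associated sequence* $(\eta_i)_{i\in\mathbb Z}$ is given by $\eta_i=+1$ (resp. $-1$) if one turns left (resp. right) when passing from $C_i$ to $C_{i+1}$. It is a *complete folding curve* if this sequence is a complete folding sequence. It then has *type $H$* (resp. *type $V$*) if all the segments $C_i$ with $i\in E_1$ (the set $E_1$ of the associated sequence) have horizontal (resp. vertical) supports. **Coverings.** A set $\mathcal E$ of segments is a *covering of $\mathbb R^2$* if (1) each interval $[(x,y),(x+1,y)]$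 or $[(x,y),(x,y+1)]$ with $x,y\in\mathbb Z$ is the support of a unique segment of $\mathcal E$, and (2) any two distinct non-consecutive segments of $\mathcal E$ with a common endpoint $X$ can be completed by segments of $\mathcal E$ into two pairs of consecutive segments, all four segments having distinct supports which contain $X$. A *covering of $\mathbb R^2$ by a set of complete folding curves* is a set of pairwise disjoint complete folding curves whose segments form a covering of $\mathbb R^2$. The tiles of these segments form the *associated tiling*. **Tilings.** A tiling $\mathcal T$ of $\mathbb R^2$ *satisfies the local isomorphism property* if for each bounded set of tiles $\mathcal F\subset\mathcal T$ there is $r>0$ such that each disk of radius $r$ contains a set of tiles of $\mathcal T$ which is the image of $\mathcal F$ under a translation. Two tilings are *locally isomorphic* if they contain the same bounded sets of tiles modulo translations. A covering by complete folding curves satisfies the local isomorphism property if its associated tiling does, and two such coverings are locally isomorphic if their associated tilings are. **Theorem.** Let $\mathcal C,\mathcal D$ be coverings of $\mathbb R^2$ by sets of complete folding curves which both satisfy the local isomorphism property. Then $\mathcal C$ and $\mathcal D$ are locally isomorphic if and only if, for each curve $C$ of $\mathcal C$ and each curve $D$ of $\mathcal D$, the curves $C$ and $D$ have the same type and have locally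 isomorphic associated sequences. -/

import Mathlib

namespace Paperfolding

noncomputable section

/-! ### Sequences with values in `{+1, -1}` -/

/-- The word `(-aₙ, …, -a₁)` obtained from `(a₁, …, aₙ)`. -/
def mirror (S : List ℤˣ) : List ℤˣ := (S.map (fun a => -a)).reverse

/-- `IsNFolding n S`: the word `S` (of length `2 ^ n - 1`) is obtained by folding `n` times a strip
of paper in two and unfolding it. The first of the `n + 1` folds is the middle one; the
remaining `n` folds are made on the two superposed halves, so that one half reads `S` and the other
one, which lies upside down, reads `mirror S`. -/
inductive IsNFolding : ℕ → List ℤˣ → Prop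
  | zero : IsNFolding 0 []
  | succ {n : ℕ} {S : List ℤˣ} (ζ : ℤˣ) (h : IsNFolding n S) :
      IsNFolding (n + 1) (mirror S ++ ζ :: S)

/-- A finite folding sequence: a subword (block of consecutive terms) of an `n`-folding sequence. -/
def IsFiniteFolding (w : List ℤˣ) : Prop :=
  ∃ (n : ℕ) (S : List ℤˣ), IsNFolding n S ∧ w <:+: S

/-- The word `(a (h + 1), …, a (h + n))`. -/
def subword (a : ℤ → ℤˣ) (h : ℤ) (n : ℕ) : List ℤˣ :=
  (List.range n).map (fun k => a (h + 1 + (k : ℤ)))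

/-- `w` is a finite subword of the bi-infinite sequence `a`. -/
def IsSubword (w : List ℤˣ) (a : ℤ → ℤˣ) : Prop :=
  ∃ (h : ℤ) (n : ℕ), w = subword a h n

/-- A complete folding sequence: all its finite subwords are folding sequences. -/
def IsCompleteFolding (a : ℤ → ℤˣ) : Prop :=
  ∀ w : List ℤˣ, IsSubword w a → IsFiniteFolding w

/-- Two bi-infinite sequences are locally isomorphic if they have the same finite subwords. -/
def SeqLocallyIsomorphic (a b : ℤ → ℤˣ) : Prop :=
  ∀ w : List ℤˣ, IsSubword w a ↔ IsSubword w b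

/-- The set `Eₙ = hₙ + 2 ^ n ℤ`, where `hₙ` is such that
`a (hₙ + k 2 ^ (n + 1)) = (-1) ^ k a hₙ` for all `k`. For a complete folding sequence such an `hₙ`
exists and `Eₙ` does not depend on it. -/
def E (n : ℕ) (a : ℤ → ℤˣ) : Set ℤ :=
  {i | ∃ h : ℤ, (∀ k : ℤ, a (h + k * 2 ^ (n + 1)) = (-1) ^ k * a h) ∧ ∃ m : ℤ, i = h + m * 2 ^ n}

/-! ### Oriented segments of curves and their tiles -/

/-- An oriented segment `C_H^±(x, y, ζ, η)` (`horiz = true`) or `C_V^±(x, y, ζ, η)`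
(`horiz = false`); the sign is `+` (from left to right, resp. from bottom to top) iff
`fwd = true`. -/
@[ext]
structure Seg where
  x : ℤ
  y : ℤ
  horiz : Bool
  fwd : Bool
  ζ : ℤˣ
  η : ℤˣ

/-- `+1` or `-1` as a real number. -/
def sgn (ε : ℤˣ) : ℝ := ((ε : ℤ) : ℝ)

/-- The point at abscissa `t` along the unit interval with lower left end `(x, y)`, displaced by `n`
in the other coordinate direction. -/
def pt (x y : ℤ) (horiz : Bool) (t n : ℝ) : ℝ × ℝ :=
  if horiz then ((x : ℝ) + t, (y : ℝ) + n) else ((x : ℝ) + n, (y : ℝ) + t)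

/-- The interval `[(x, y), (x + 1, y)]` or `[(x, y), (x, y + 1)]`. -/
def unitInterval (x y : ℤ) (horiz : Bool) : Set (ℝ × ℝ) :=
  segment ℝ (pt x y horiz 0 0) (pt x y horiz 1 0)

namespace Seg

/-- The support of a segment. -/
def support (s : Seg) : Set (ℝ × ℝ) := unitInterval s.x s.y s.horiz

/-- The set of points of a segment: a broken line with three pieces. -/
def points (α : ℝ) (s : Seg) : Set (ℝ × ℝ) :=
  segment ℝ (pt s.x s.y s.horiz α (sgn s.ζ * α)) (pt s.x s.y s.horiz (2 * α) 0) ∪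
  segment ℝ (pt s.x s.y s.horiz (2 * α) 0) (pt s.x s.y s.horiz (1 - 2 * α) 0) ∪
  segment ℝ (pt s.x s.y s.horiz (1 - 2 * α) 0) (pt s.x s.y s.horiz (1 - α) (sgn s.η * α))

/-- The point of `ℝ²` where the oriented segment begins. -/
def beginning (α : ℝ) (s : Seg) : ℝ × ℝ :=
  if s.fwd then pt s.x s.y s.horiz α (sgn s.ζ * α) else pt s.x s.y s.horiz (1 - α) (sgn s.η * α)

/-- The point of `ℝ²` where the oriented segment ends. -/
def ending (α : ℝ) (s : Seg) : ℝ × ℝ :=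
  if s.fwd then pt s.x s.y s.horiz (1 - α) (sgn s.η * α) else pt s.x s.y s.horiz α (sgn s.ζ * α)

/-- The two endpoints of (the support of) a segment. -/
def endpoints (s : Seg) : Set (ℤ × ℤ) :=
  {(s.x, s.y), if s.horiz then (s.x + 1, s.y) else (s.x, s.y + 1)}

/-- The unit vector that gives the direction of the oriented support. -/
def dir (s : Seg) : ℤ × ℤ :=
  if s.horiz then (if s.fwd then (1, 0) else (-1, 0)) else (if s.fwd then (0, 1) else (0, -1))

/-- Coordinate of `p` along the support, measured from the left (resp. bottom) end. -/
def along (s : Seg) (p : ℝ × ℝ) : ℝ := if s.horiz then p.1 - s.x else p.2 - s.y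

/-- Coordinate of `p` across the support. -/
def across (s : Seg) (p : ℝ × ℝ) : ℝ := if s.horiz then p.2 - s.y else p.1 - s.x

/-- The tile associated to an oriented segment: the square (diamond) which has the support as a
diagonal, with a square bump (side `2 α`) added around the ending and an open square
dent removed around the beginning. -/
def tile (α : ℝ) (s : Seg) : Set (ℝ × ℝ) :=
  if s.fwd then
    ({p | |s.along p - 1 / 2| + |s.across p| ≤ 1 / 2} ∪
      {p | max |s.along p - (1 - α)| |s.across p - sgn s.η * α| ≤ α}) \
      {p | max |s.along p - α| |s.across p - sgn s.ζ * α| < α}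
  else
    ({p | |s.along p - 1 / 2| + |s.across p| ≤ 1 / 2} ∪
      {p | max |s.along p - α| |s.across p - sgn s.ζ * α| ≤ α}) \
      {p | max |s.along p - (1 - α)| |s.across p - sgn s.η * α| < α}

end Seg

/-- `s, t` are consecutive (in this order): they have just one common point, and the end of `s` is
the beginning of `t`. -/
def Consecutive (α : ℝ) (s t : Seg) : Prop :=
  s.points α ∩ t.points α = {s.ending α} ∧ s.ending α = t.beginning α

/-- `+1` if one turns left when passing from `s` to `t`, `-1` if one turns right (for consecutive
segments, whose supports form a right angle). -/
def turn (s t : Seg) : ℤˣ :=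
  if 0 < s.dir.1 * t.dir.2 - s.dir.2 * t.dir.1 then 1 else -1

/-! ### Complete curves -/

/-- A complete curve: a sequence indexed by `ℤ` of consecutive segments with distinct supports. -/
def IsCompleteCurve (α : ℝ) (C : ℤ → Seg) : Prop :=
  (∀ i : ℤ, Consecutive α (C i) (C (i + 1))) ∧ Function.Injective (fun i => (C i).support)

/-- The sequence of turns associated to a complete curve. -/
def turnSeq (C : ℤ → Seg) : ℤ → ℤˣ := fun i => turn (C i) (C (i + 1))

/-- A complete folding curve: a complete curve associated to a complete folding sequence. -/
def IsCompleteFoldingCurve (α : ℝ) (C : ℤ → Seg) : Prop :=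
  IsCompleteCurve α C ∧ IsCompleteFolding (turnSeq C)

/-- The set of points of a curve. -/
def curvePoints (α : ℝ) (C : ℤ → Seg) : Set (ℝ × ℝ) := ⋃ i : ℤ, (C i).points α

/-- Type `H`: the segments `C i`, `i ∈ E₁`, have horizontal supports. -/
def IsTypeH (C : ℤ → Seg) : Prop := ∀ i ∈ E 1 (turnSeq C), (C i).horiz = true

/-- Type `V`: the segments `C i`, `i ∈ E₁`, have vertical supports. -/
def IsTypeV (C : ℤ → Seg) : Prop := ∀ i ∈ E 1 (turnSeq C), (C i).horiz = false

/-- The two curves have the same type. -/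
def SameType (C D : ℤ → Seg) : Prop := (IsTypeH C ∧ IsTypeH D) ∨ (IsTypeV C ∧ IsTypeV D)

/-! ### Coverings of the plane -/

/-- A set `S` of segments is a covering of `ℝ²` if every unit interval of the lattice is
the support of a unique element of `S`, and any two distinct non consecutive elements of `S` with a
common endpoint `X` can be completed (in `S`) into pairs of consecutive segments, all four
segments having distinct supports which contain `X`. -/
def IsCovering (α : ℝ) (S : Set Seg) : Prop :=
  (∀ (x y : ℤ) (horiz : Bool), ∃! s : Seg, s ∈ S ∧ s.support = unitInterval x y horiz) ∧
  (∀ s ∈ S, ∀ t ∈ S, s ≠ t → ¬ Consecutive α s t → ¬ Consecutive α t s →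
    ∀ X : ℤ × ℤ, X ∈ s.endpoints → X ∈ t.endpoints →
      ∃ s' ∈ S, ∃ t' ∈ S,
        (Consecutive α s s' ∨ Consecutive α s' s) ∧ (Consecutive α t t' ∨ Consecutive α t' t) ∧
        X ∈ s'.endpoints ∧ X ∈ t'.endpoints ∧
        [s.support, s'.support, t.support, t'.support].Nodup)

/-- The segments of the curves of `K`. -/
def segments (K : Set (ℤ → Seg)) : Set Seg := {s | ∃ C ∈ K, ∃ i : ℤ, s = C i}

/-- `K` is a covering of `ℝ²` by a set of (pairwise disjoint) complete folding curves. -/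
def IsCoveringByCurves (α : ℝ) (K : Set (ℤ → Seg)) : Prop :=
  (∀ C ∈ K, IsCompleteFoldingCurve α C) ∧
  (∀ C ∈ K, ∀ D ∈ K, C ≠ D → Disjoint (curvePoints α C) (curvePoints α D)) ∧
  IsCovering α (segments K)

/-- The tiling of `ℝ²` associated to a covering by curves. -/
def tiling (α : ℝ) (K : Set (ℤ → Seg)) : Set (Set (ℝ × ℝ)) := Seg.tile α '' segments K

/-! ### Local isomorphism of tilings of `ℝ²` -/

/-- The image of a set of tiles under the translation by `v`. -/
def translate (v : ℝ × ℝ) (F : Set (Set (ℝ × ℝ))) : Set (Set (ℝ × ℝ)) :=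
  (fun P : Set (ℝ × ℝ) => (fun p : ℝ × ℝ => v + p) '' P) '' F

/-- `F` is a bounded set of tiles of `T`. -/
def IsBoundedPatch (T F : Set (Set (ℝ × ℝ))) : Prop := F ⊆ T ∧ Bornology.IsBounded (⋃₀ F)

/-- The euclidean disk with center `c` and radius `r`. -/
def disk (c : ℝ × ℝ) (r : ℝ) : Set (ℝ × ℝ) := {p | (p.1 - c.1) ^ 2 + (p.2 - c.2) ^ 2 ≤ r ^ 2}

/-- `T` satisfies the local isomorphism property: for each bounded set `F` of tiles of `T` there is
`r > 0` such that each disk of radius `r` contains a set of tiles of `T` which is the image of `F`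
under a translation. -/
def LocalIsomorphismProperty (T : Set (Set (ℝ × ℝ))) : Prop :=
  ∀ F, IsBoundedPatch T F → ∃ r : ℝ, 0 < r ∧ ∀ c : ℝ × ℝ, ∃ v : ℝ × ℝ,
    translate v F ⊆ T ∧ ⋃₀ (translate v F) ⊆ disk c r

/-- `T` and `U` are locally isomorphic: they contain the same bounded sets of tiles modulo
translations. -/
def LocallyIsomorphic (T U : Set (Set (ℝ × ℝ))) : Prop :=
  (∀ F, IsBoundedPatch T F → ∃ v : ℝ × ℝ, translate v F ⊆ U) ∧
  (∀ F, IsBoundedPatch U F → ∃ v : ℝ × ℝ, translate v F ⊆ T)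

end

end Paperfolding

namespace Paperfolding

/-! ### Structure of folding sequences -/

/-! The proof compares a whole covering with any single one of its curves. Every complete folding
curve contains arbitrarily large lattice boxes all of whose edges it traverses
(`IsFoldingWalk.exists_full_box`). Under the local isomorphism property, each bounded patch of a
covering recurs in every disk of some radius, hence over such a box of any chosen curve. By
uniqueness of the segment on each support, that copy consists of segments of this curve alone
(`exists_translate_subset_curve`). Local isomorphism of coverings thus becomes a comparison of
finite blocks of two curves.

If the coverings are locally isomorphic, each block of $C$ has a translate in $D$. A tile determines
its segment up to translation (`Seg.eq_shift_of_tile_eq`), so the turns agree. The types agree as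
well, because a short window of turns determines the places of $E_1$ (`parity_unique`).

Conversely, a common subword places a block of $D$ with the same turns as a block of $C$, and
equality of types makes corresponding supports parallel. The two blocks then differ by a translation
or by a half-turn. The half-turn is removed by `IsWalk.exists_reversed_window`: each block of a
folding sequence recurs along the curve with the opposite direction.

Both geometric facts rest on self-similarity. Deleting the alternating half of a complete folding
sequence leaves a complete folding sequence (`IsCompleteFolding.decomp`), and taking every second
vertex of its walk, divided by $1+i$, gives the walk of that sequence (`IsWalk.derive`). Reversed
windows follow by induction on length. Full boxes come from the inverse operation: two unfoldings
double a full triangle, and a finite search supplies the first one. -/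

/-- The word `(c, s₁, -c, s₂, c, …)` that interleaves an alternating word with `S`. -/
def weave : ℤˣ → List ℤˣ → List ℤˣ
  | c, [] => [c]
  | c, x :: xs => c :: x :: weave (-c) xs

/-- Weaving `A` uses `A.length + 1` alternating terms, which accounts for the sign carried to the
second block. -/
lemma weave_append (A B : List ℤˣ) (c ζ : ℤˣ) :
    weave c A ++ ζ :: weave ((-1) ^ (A.length + 1) * c) B = weave c (A ++ ζ :: B) := by
  induction A generalizing c with
  | nil => simp [weave]
  | cons x xs ih =>
    have := ih (-c)
    simp only [weave, List.cons_append, List.length_cons]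
    rw [← this]
    congr 5
    rw [pow_succ _ (xs.length + 1)]
    simp

lemma mirror_cons (x : ℤˣ) (S : List ℤˣ) : mirror (x :: S) = mirror S ++ [-x] := by
  simp [mirror]

lemma length_mirror (S : List ℤˣ) : (mirror S).length = S.length := by simp [mirror]

lemma mirror_weave (S : List ℤˣ) (c : ℤˣ) :
    mirror (weave c S) = weave ((-1) ^ (S.length + 1) * c) (mirror S) := by
  induction S generalizing c with
  | nil => simp [weave, mirror]
  | cons x xs ih =>
    rw [weave, mirror_cons, mirror_cons, mirror_cons, ih, ← weave_append]
    simp only [length_mirror, List.length_cons, List.append_assoc, List.cons_append,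
      List.nil_append, weave]
    have e : (-1 : ℤˣ) ^ (xs.length + 1) * -c = (-1) ^ (xs.length + 1 + 1) * c := by
      rw [pow_succ _ (xs.length + 1)]; simp
    have e' : (-1 : ℤˣ) ^ (xs.length + 1) * ((-1) ^ (xs.length + 1 + 1) * c) = -c := by
      rw [← mul_assoc, ← pow_add, show xs.length + 1 + (xs.length + 1 + 1)
        = 2 * (xs.length + 1) + 1 by ring, pow_succ, pow_mul]
      simp
    rw [e, e']

/-- The recursion in the definition adds the middle fold, while this one isolates the creases of the
last fold. Induction passes between the two: mirroring a weave gives a weave, and the two signs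
$(-1)^{|S'|+1}$ cancel across the middle fold. -/
lemma IsNFolding.exists_weave {n : ℕ} {T : List ℤˣ} (h : IsNFolding (n + 1) T) :
    ∃ c S, IsNFolding n S ∧ T = weave c S := by
  induction n generalizing T with
  | zero =>
    cases h with
    | succ ζ h =>
      cases h
      exact ⟨ζ, [], .zero, by simp [mirror, weave]⟩
  | succ n ih =>
    cases h with
    | @succ _ S ζ h =>
      obtain ⟨c, S', hS', rfl⟩ := ih h
      refine ⟨(-1) ^ (S'.length + 1) * c, mirror S' ++ ζ :: S', .succ ζ hS', ?_⟩
      rw [mirror_weave, ← weave_append, length_mirror]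
      congr 2
      rw [← mul_assoc, ← pow_add, ← two_mul, pow_mul]
      simp

lemma weave_getElem_even (S : List ℤˣ) (c x : ℤˣ) (j : ℕ) (h : (weave c S)[2 * j]? = some x) :
    x = (-1) ^ j * c := by
  induction j generalizing S c with
  | zero => cases S <;> simp_all [weave]
  | succ j ih =>
    cases S with
    | nil => simp [weave, mul_add] at h
    | cons y ys =>
      have := ih ys (-c) (by simpa [weave, mul_add] using h)
      rw [this, pow_succ]; simp

lemma weave_getElem_odd (S : List ℤˣ) (c : ℤˣ) (j : ℕ) :
    (weave c S)[2 * j + 1]? = S[j]? := by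
  induction j generalizing S c with
  | zero => cases S <;> simp [weave]
  | succ j ih =>
    cases S with
    | nil => simp [weave]
    | cons y ys => simpa [weave, mul_add] using ih ys (-c)

lemma infix_of_getElem {S : List ℤˣ} {f : ℕ → ℤˣ} {j n : ℕ}
    (h : ∀ k < n, S[j + k]? = some (f k)) : (List.range n).map f <:+: S := by
  have : (List.range n).map f = (S.drop j).take n := by
    apply List.ext_getElem?
    intro k
    by_cases hk : k < n
    · simp [hk, h k hk]
    · simp [hk]
  rw [this]
  exact (List.take_prefix _ _).isInfix.trans (List.drop_suffix _ _).isInfix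

lemma subword_eq (a : ℤ → ℤˣ) (h : ℤ) (n : ℕ) :
    subword a h n = (List.range n).map (fun k : ℕ => a (h + 1 + k)) := by
  unfold subword
  simp [List.map_eq_flatMap, List.flatMap_assoc]

/-- The window `[-N, N]` of `a` is a block of `weave c S` for some `n`-folding sequence `S`, the
alternating terms being at the places congruent to `r` modulo `2`. -/
def FitsWeave (a : ℤ → ℤˣ) (N : ℕ) (r : ℤ) : Prop :=
  ∃ (n : ℕ) (S : List ℤˣ) (c : ℤˣ) (o : ℤ), IsNFolding n S ∧ (o + r) % 2 = 0 ∧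
    ∀ i : ℤ, -N ≤ i → i ≤ N → ∃ m : ℕ, (m : ℤ) = i + o ∧ (weave c S)[m]? = some (a i)

lemma FitsWeave.mono {a : ℤ → ℤˣ} {N M : ℕ} {r : ℤ} (h : FitsWeave a M r) (hNM : N ≤ M) :
    FitsWeave a N r := by
  obtain ⟨n, S, c, o, h1, h2, h3⟩ := h
  exact ⟨n, S, c, o, h1, h2, fun i hi hi' => h3 i (by omega) (by omega)⟩

lemma IsCompleteFolding.fitsWeave {a : ℤ → ℤˣ} (h : IsCompleteFolding a) (N : ℕ) :
    FitsWeave a N 0 ∨ FitsWeave a N 1 := by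
  obtain ⟨n, T, hT, A, B, hAB⟩ := h _ ⟨-N - 1, 2 * N + 1, rfl⟩
  have key : ∀ i : ℤ, -N ≤ i → i ≤ N → ∃ m : ℕ, (m : ℤ) = i + (A.length + N : ℤ) ∧
      T[m]? = some (a i) := by
    intro i hi hi'
    refine ⟨A.length + (i + N).toNat, by omega, ?_⟩
    rw [← hAB, List.append_assoc, List.getElem?_append_right (by omega), List.getElem?_append_left]
    · simp only [subword_eq, List.getElem?_map, Nat.add_sub_cancel_left]
      rw [List.getElem?_range (by omega)]
      simp only [Option.map_some]
      congr 2
      omega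
    · simp [subword_eq]; omega
  cases n with
  | zero =>
    cases hT
    obtain ⟨m, -, hm⟩ := key 0 (by omega) (by omega)
    simp at hm
  | succ n =>
    obtain ⟨c, S, hS, rfl⟩ := hT.exists_weave
    rcases Int.emod_two_eq_zero_or_one (A.length + N : ℤ) with h0 | h0
    · exact Or.inl ⟨n, S, c, _, hS, by omega, key⟩
    · exact Or.inr ⟨n, S, c, _, hS, by omega, key⟩

/-- A compactness argument: fitting a large window implies fitting the smaller ones, so if each
parity failed on some window, both would fail on the larger of the two. -/
lemma IsCompleteFolding.exists_parity {a : ℤ → ℤˣ} (h : IsCompleteFolding a) :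
    ∃ r : ℤ, ∀ N, FitsWeave a N r := by
  by_contra! hc
  obtain ⟨N, hN⟩ := hc 0
  obtain ⟨M, hM⟩ := hc 1
  rcases h.fitsWeave (max N M) with h' | h'
  · exact hN (h'.mono (le_max_left _ _))
  · exact hM (h'.mono (le_max_right _ _))

/-- A complete folding sequence consists of an alternating sequence, at the places congruent to
some `g` modulo `2`, and of a complete folding sequence at the other places. -/
theorem IsCompleteFolding.decomp {a : ℤ → ℤˣ} (h : IsCompleteFolding a) :
    ∃ g : ℤ, (∀ k : ℤ, a (g + 2 * k + 2) = -a (g + 2 * k)) ∧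
      IsCompleteFolding (fun k => a (g + 1 + 2 * k)) := by
  obtain ⟨g, hg⟩ := h.exists_parity
  refine ⟨g, fun k => ?_, ?_⟩
  · obtain ⟨n, S, c, o, hS, ho, hw⟩ := hg (g + 2 * k).natAbs.succ.succ
    obtain ⟨m, hm, hm'⟩ := hw (g + 2 * k) (by omega) (by omega)
    obtain ⟨l, hl, hl'⟩ := hw (g + 2 * k + 2) (by omega) (by omega)
    obtain ⟨j, rfl⟩ : ∃ j, m = 2 * j := ⟨m / 2, by omega⟩
    obtain rfl : l = 2 * (j + 1) := by omega
    rw [weave_getElem_even _ _ _ _ hm', weave_getElem_even _ _ _ _ hl', pow_succ]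
    simp
  · rintro w ⟨x, len, rfl⟩
    obtain ⟨n, S, c, o, hS, ho, hw⟩ := hg ((g + 1 + 2 * (x + 1)).natAbs + 2 * len)
    refine ⟨n, S, hS, ?_⟩
    rcases Nat.eq_zero_or_pos len with rfl | hlen
    · simp [subword]
    obtain ⟨m, hm, -⟩ := hw (g + 1 + 2 * (x + 1)) (by omega) (by omega)
    rw [subword_eq]
    refine infix_of_getElem (j := m / 2) fun k hk => ?_
    obtain ⟨l, hl, hl'⟩ := hw (g + 1 + 2 * (x + 1 + k)) (by omega) (by omega)
    rw [← hl', ← weave_getElem_odd S c]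
    congr 1
    omega

lemma neg_ne_self (u : ℤˣ) : -u ≠ u := by
  rcases Int.units_eq_one_or u with rfl | rfl <;> decide

lemma alternates_pow {a : ℤ → ℤˣ} {g : ℤ} (h : ∀ k : ℤ, a (g + 2 * k + 2) = -a (g + 2 * k))
    (k : ℤ) : a (g + 2 * k) = (-1) ^ k * a g := by
  induction k using Int.induction_on with
  | zero => simp
  | succ n ih =>
    rw [show g + 2 * ((n : ℤ) + 1) = g + 2 * n + 2 by ring, h, ih, zpow_add]
    simp
  | pred n ih =>
    have := h (-n - 1)
    rw [show g + 2 * (-(n : ℤ) - 1) + 2 = g + 2 * -n by ring, ih] at this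
    rw [zpow_sub, zpow_one, ← neg_eq_iff_eq_neg.mpr this]
    simp

/-- A place of the alternating class has the same sign four places later, so it cannot serve as $h$.
In the other class, a suitable $h$ comes from decomposing the derived sequence once more. -/
lemma E_one_eq {a : ℤ → ℤˣ} {g : ℤ} (h : ∀ k : ℤ, a (g + 2 * k + 2) = -a (g + 2 * k))
    (h' : IsCompleteFolding (fun k => a (g + 1 + 2 * k))) :
    E 1 a = {i | ∃ m : ℤ, i = g + 1 + 2 * m} := by
  ext i
  constructor
  · rintro ⟨x, hx, m, rfl⟩
    rcases Int.emod_two_eq_zero_or_one (x - g) with h0 | h0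
    · exfalso
      obtain ⟨k, hk⟩ : ∃ k, x = g + 2 * k := ⟨(x - g) / 2, by omega⟩
      have h1 := hx 1
      have h2 := h k
      have h3 := h (k + 1)
      rw [show g + 2 * (k + 1) + 2 = x + 1 * 2 ^ (1 + 1) by rw [hk]; ring,
        show g + 2 * (k + 1) = g + 2 * k + 2 by ring, h2, h1, ← hk] at h3
      simp at h3
    · exact ⟨(x - g - 1) / 2 + m, by omega⟩
  · rintro ⟨m, rfl⟩
    obtain ⟨r, hr, -⟩ := h'.decomp
    refine ⟨g + 1 + 2 * r, fun k => ?_, m - r, by ring⟩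
    have := alternates_pow (a := fun k => a (g + 1 + 2 * k)) hr k
    rw [← this]
    congr 1
    ring

/-- The places where two complete folding sequences alternate correspond in any window of length
`9` on which the sequences agree. -/
lemma parity_unique {a b : ℤ → ℤˣ} {g r x s : ℤ}
    (ha' : IsCompleteFolding (fun k => a (g + 1 + 2 * k)))
    (hb : ∀ k : ℤ, b (r + 2 * k + 2) = -b (r + 2 * k))
    (hab : ∀ i, x ≤ i → i < x + 9 → b (i + s) = a i) : (r - (g + s)) % 2 = 0 := by
  by_contra hc
  obtain ⟨t, ht, -⟩ := ha'.decomp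
  -- The `+ 3` rounds up, so `y` is the first place from `x` on in its class modulo 4. With
  -- mismatched parities, alternation of `b` gives `a (y + 4) = a y`, whereas the derived sequence
  -- of `a` forces the opposite sign.
  set k := (x - (g + 1 + 2 * t) + 3) / 4 with hk
  have h1 := ht k
  set y := g + 1 + 2 * (t + 2 * k) with hy
  have h2 : ∀ i, x ≤ i → i + 2 < x + 9 → (i - y) % 2 = 0 → a (i + 2) = -a i := by
    intro i hi hi' hp
    rw [← hab i hi (by omega), ← hab (i + 2) (by omega) (by omega)]
    have := hb ((i + s - r) / 2)
    rwa [show r + 2 * ((i + s - r) / 2) = i + s by omega, add_right_comm] at this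
  have h3 := h2 y (by omega) (by omega) (by omega)
  have h4 := h2 (y + 2) (by omega) (by omega) (by omega)
  rw [h3, neg_neg] at h4
  rw [show g + 1 + 2 * (t + 2 * k + 2) = y + 2 + 2 by rw [hy]; ring, h4] at h1
  exact neg_ne_self _ h1.symm

/-! ### Reversals of direction -/

/-- `y` alternates at the places of one parity and, among the other places, at those of one class
modulo `4`. -/
def AltFold (y : ℕ → ℤˣ) : Prop :=
  ((∀ k, y (2 * k + 2) = -y (2 * k)) ∧
    ((∀ k, y (4 * k + 5) = -y (4 * k + 1)) ∨ ∀ k, y (4 * k + 7) = -y (4 * k + 3))) ∨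
  ((∀ k, y (2 * k + 3) = -y (2 * k + 1)) ∧
    ((∀ k, y (4 * k + 4) = -y (4 * k)) ∨ ∀ k, y (4 * k + 6) = -y (4 * k + 2)))

-- Here `u` and `w` are the turns at the two parities and `ε` is the direction relative to the start
-- after each pair of steps. The alternation relations leave at most six free signs among the terms
-- involved, and exhaustive checking shows that some `m` between 1 and 8 works.
set_option synthInstance.maxSize 10000 in
set_option synthInstance.maxHeartbeats 400000 in
set_option maxRecDepth 10000 in
lemma exists_reversal {u w ε : ℕ → ℤˣ} (h0 : ε 0 = 1) (hε : ∀ m, ε (m + 1) = -(u m * w m * ε m))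
    (h : ((∀ k, u (k + 1) = -u k) ∧ AltFold w) ∨ ((∀ k, w (k + 1) = -w k) ∧ AltFold u)) :
    ∃ m, u m = u 0 ∧ ε m = -1 := by
  by_contra! hc
  have c1 := hc 1
  have c2 := hc 2
  have c3 := hc 3
  have c4 := hc 4
  have c5 := hc 5
  have c6 := hc 6
  have c7 := hc 7
  have c8 := hc 8
  clear hc
  simp only [hε, h0] at c1 c2 c3 c4 c5 c6 c7 c8
  rcases h with ⟨h, ⟨h', h'' | h''⟩ | ⟨h', h'' | h''⟩⟩ | ⟨h, ⟨h', h'' | h''⟩ | ⟨h', h'' | h''⟩⟩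
  all_goals
    have e0 := h' 0
    have e1 := h' 1
    have e2 := h' 2
    have e3 := h' 3
    have f0 := h'' 0
    have f1 := h'' 1
    norm_num at e0 e1 e2 e3 f0 f1
    simp only [h, e0, e1, e2, e3, f0, f1, neg_neg, mul_neg, neg_mul,
      mul_one] at c1 c2 c3 c4 c5 c6 c7 c8
    revert c1 c2 c3 c4 c5 c6 c7 c8
  · generalize u 0 = v0, w 0 = v1, w 1 = v2, w 3 = v3, w 7 = v4
    clear * -
    decide +revert
  · generalize u 0 = v0, w 0 = v1, w 1 = v2, w 3 = v3, w 5 = v4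
    clear * -
    decide +revert
  · generalize u 0 = v0, w 0 = v1, w 1 = v2, w 2 = v3, w 6 = v4
    clear * -
    decide +revert
  · generalize u 0 = v0, w 0 = v1, w 1 = v2, w 2 = v3, w 4 = v4, w 8 = v5
    clear * -
    decide +revert
  · generalize w 0 = v0, u 0 = v1, u 1 = v2, u 3 = v3, u 7 = v4
    clear * -
    decide +revert
  · generalize w 0 = v0, u 0 = v1, u 1 = v2, u 3 = v3, u 5 = v4
    clear * -
    decide +revert
  · generalize w 0 = v0, u 0 = v1, u 1 = v2, u 2 = v3, u 6 = v4
    clear * -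
    decide +revert
  · generalize w 0 = v0, u 0 = v1, u 1 = v2, u 2 = v3, u 4 = v4, u 8 = v5
    clear * -
    decide +revert

/-! ### Walks on the Gaussian integers -/

/-- The Gaussian integer `i`. -/
def imUnit : GaussianInt := ⟨0, 1⟩

local notation "𝐢" => imUnit

lemma imUnit_mul_self : 𝐢 * 𝐢 = -1 := by decide

lemma imUnit_ne_zero : 𝐢 ≠ 0 := by decide

lemma one_add_imUnit_ne_zero : 1 + 𝐢 ≠ 0 := by decide

/-- The four unit vectors of the lattice. -/
def IsDir (u : GaussianInt) : Prop := u = 1 ∨ u = -1 ∨ u = 𝐢 ∨ u = -𝐢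

lemma IsDir.neg {u : GaussianInt} (h : IsDir u) : IsDir (-u) := by
  rcases h with rfl | rfl | rfl | rfl <;> simp [IsDir]

lemma IsDir.imUnit_mul {u : GaussianInt} (h : IsDir u) : IsDir (𝐢 * u) := by
  rcases h with rfl | rfl | rfl | rfl <;> simp [IsDir, imUnit_mul_self]

lemma IsDir.mul {u v : GaussianInt} (h : IsDir u) (h' : IsDir v) : IsDir (u * v) := by
  rcases h with rfl | rfl | rfl | rfl <;> simp [h', h'.neg, h'.imUnit_mul, h'.imUnit_mul.neg]

/-- The sum of the coordinates, whose parity colours the lattice as a chessboard. -/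
def coordSum (z : GaussianInt) : ℤ := z.re + z.im

lemma coordSum_add (z w : GaussianInt) : coordSum (z + w) = coordSum z + coordSum w := by
  simp [coordSum]; ring

lemma coordSum_sub (z w : GaussianInt) : coordSum (z - w) = coordSum z - coordSum w := by
  simp [coordSum]; ring

lemma coordSum_dir_mul {u : GaussianInt} (h : IsDir u) (z : GaussianInt) :
    (coordSum (u * z) - coordSum z) % 2 = 0 := by
  rcases h with rfl | rfl | rfl | rfl <;> simp [coordSum, imUnit] <;> omega

lemma coordSum_dir {u : GaussianInt} (h : IsDir u) : coordSum u % 2 = 1 := by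
  rcases h with rfl | rfl | rfl | rfl <;> simp [coordSum, imUnit]

/-- A walk `p` whose turns are given by `a`: a left turn at `p j` if `a j = 1`, a right turn if
`a j = -1`. -/
structure IsWalk (a : ℤ → ℤˣ) (p : ℤ → GaussianInt) : Prop where
  isDir : ∀ j, IsDir (p j - p (j - 1))
  turn : ∀ j, p (j + 1) - p j = ((a j : ℤ) : GaussianInt) * 𝐢 * (p j - p (j - 1))

lemma IsWalk.coordSum_mod {a : ℤ → ℤˣ} {p : ℤ → GaussianInt} (h : IsWalk a p) (j : ℤ) :
    (coordSum (p j) - coordSum (p 0) - j) % 2 = 0 := by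
  have step : ∀ j, (coordSum (p j) - coordSum (p (j - 1))) % 2 = 1 := fun j => by
    rw [← coordSum_sub]; exact coordSum_dir (h.isDir j)
  induction j using Int.induction_on with
  | zero => simp
  | succ n ih => have := step (n + 1); rw [add_sub_cancel_right] at this; omega
  | pred n ih => have := step (-n); omega

lemma exists_one_add_imUnit_mul {z : GaussianInt} (h : coordSum z % 2 = 0) :
    ∃ w, (1 + 𝐢) * w = z := by
  refine ⟨⟨(z.re + z.im) / 2, (z.im - z.re) / 2⟩, ?_⟩
  simp only [coordSum] at h
  ext <;> simp [imUnit] <;> omega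

/-- The walk through every second vertex of a walk with alternate turns, rescaled. -/
theorem IsWalk.derive {a : ℤ → ℤˣ} {p : ℤ → GaussianInt} {g : ℤ} (h : IsWalk a p)
    (hg : ∀ k : ℤ, a (g + 2 * k + 2) = -a (g + 2 * k)) :
    ∃ q, IsWalk (fun k => a (g + 1 + 2 * k)) q ∧
      (∀ k, p (g + 1 + 2 * k) = p (g + 1) + (1 + 𝐢) * q k) ∧
      ∀ k, (a (g + 2 * k) = 1 ∧ p (g + 2 * k) - p (g + 2 * k - 1) = q k - q (k - 1)) ∨
        (a (g + 2 * k) = -1 ∧ p (g + 2 * k) - p (g + 2 * k - 1) = 𝐢 * (q k - q (k - 1))) := by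
  have hI := imUnit_mul_self
  have ex : ∀ k : ℤ, ∃ w, (1 + 𝐢) * w = p (g + 1 + 2 * k) - p (g + 1) := fun k => by
    apply exists_one_add_imUnit_mul
    have h1 := h.coordSum_mod (g + 1 + 2 * k)
    have h2 := h.coordSum_mod (g + 1)
    rw [coordSum_sub]
    omega
  choose q hq using ex
  have hd : ∀ k, (a (g + 2 * k) = 1 ∧ p (g + 2 * k) - p (g + 2 * k - 1) = q k - q (k - 1)) ∨
      (a (g + 2 * k) = -1 ∧ p (g + 2 * k) - p (g + 2 * k - 1) = 𝐢 * (q k - q (k - 1))) := by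
    intro k
    have h1 := hq k
    have h2 := hq (k - 1)
    have h3 := h.turn (g + 2 * k)
    rw [show g + 1 + 2 * (k - 1) = g + 2 * k - 1 by ring] at h2
    rw [show g + 1 + 2 * k = g + 2 * k + 1 by ring] at h1
    rcases Int.units_eq_one_or (a (g + 2 * k)) with h4 | h4 <;> rw [h4] at h3 <;> simp at h3
    · refine Or.inl ⟨h4, mul_left_cancel₀ one_add_imUnit_ne_zero ?_⟩
      linear_combination h2 - h1 - h3
    · refine Or.inr ⟨h4, mul_left_cancel₀ one_add_imUnit_ne_zero ?_⟩
      linear_combination 𝐢 * (h2 - h1 - h3) + (p (g + 2 * k) - p (g + 2 * k - 1)) * hI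
  refine ⟨q, ⟨fun k => ?_, fun k => ?_⟩, fun k => by rw [hq]; ring, hd⟩
  · have h1 := h.isDir (g + 2 * k)
    rcases hd k with ⟨-, h2⟩ | ⟨-, h2⟩
    · rwa [← h2]
    · have : q k - q (k - 1) = -(𝐢 * (p (g + 2 * k) - p (g + 2 * k - 1))) := by
        rw [h2]; linear_combination (q k - q (k - 1)) * hI
      rw [this]
      exact h1.imUnit_mul.neg
  · have h1 := h.turn (g + 2 * k)
    have h2 := h.turn (g + 1 + 2 * k)
    have h3 := hd k
    have h4 := hd (k + 1)
    rw [show g + 2 * (k + 1) = g + 2 * k + 2 by ring, hg, add_sub_cancel_right] at h4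
    rw [show g + 1 + 2 * k + 1 = g + 2 * k + 2 by ring,
      show g + 1 + 2 * k - 1 = g + 2 * k by ring, show g + 1 + 2 * k = g + 2 * k + 1 by ring] at h2
    rw [show g + 2 * k + 2 - 1 = g + 2 * k + 1 by ring] at h4
    simp only [show g + 1 + 2 * k = g + 2 * k + 1 by ring]
    generalize ((a (g + 2 * k + 1) : ℤ) : GaussianInt) = b at *
    rcases h3 with ⟨h5, h3⟩ | ⟨h5, h3⟩ <;> rw [h5] at h1 h4 <;> simp at h1 h4
    · refine mul_left_cancel₀ imUnit_ne_zero ?_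
      linear_combination -h4 + h2 + b * 𝐢 * h1 + b * 𝐢 * 𝐢 * h3
    · linear_combination -h4 + h2 + b * 𝐢 * h1 - b * 𝐢 * 𝐢 * h3 -
        b * 𝐢 * (q k - q (k - 1)) * hI

lemma IsCompleteFolding.altFold {a : ℤ → ℤˣ} (h : IsCompleteFolding a) (t : ℤ) :
    AltFold (fun m => a (t + m)) := by
  obtain ⟨g, hg, h'⟩ := h.decomp
  obtain ⟨r, hr, -⟩ := h'.decomp
  have hr' : ∀ i j, (i - (g + 1 + 2 * r)) % 4 = 0 → j = i + 4 → a j = -a i := by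
    rintro i _ hi rfl
    have := hr ((i - (g + 1 + 2 * r)) / 4)
    convert this using 2 <;> [skip; congr 1] <;> omega
  have hg' : ∀ i j, (i - g) % 2 = 0 → j = i + 2 → a j = -a i := by
    rintro i _ hi rfl
    have := hg ((i - g) / 2)
    convert this using 3 <;> omega
  rcases Int.emod_two_eq_zero_or_one (t - g) with h0 | h0
  · refine Or.inl ⟨fun k => hg' _ _ (by omega) (by omega), ?_⟩
    by_cases h1 : (t + 1 - (g + 1 + 2 * r)) % 4 = 0
    · exact Or.inl fun k => hr' _ _ (by omega) (by omega)
    · exact Or.inr fun k => hr' _ _ (by omega) (by omega)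
  · refine Or.inr ⟨fun k => hg' _ _ (by omega) (by omega), ?_⟩
    by_cases h1 : (t - (g + 1 + 2 * r)) % 4 = 0
    · exact Or.inl fun k => hr' _ _ (by omega) (by omega)
    · exact Or.inr fun k => hr' _ _ (by omega) (by omega)

lemma IsWalk.exists_reversal {a : ℤ → ℤˣ} {p : ℤ → GaussianInt} (h : IsWalk a p)
    (ha : IsCompleteFolding a) (x : ℤ) :
    ∃ s : ℤ, s % 2 = 0 ∧ a (x + s) = a x ∧ p (x + s) - p (x + s - 1) = -(p x - p (x - 1)) := by
  obtain ⟨g, hg, h'⟩ := ha.decomp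
  -- Two successive turns multiply the direction by $(a_j i)(a_{j+1} i) = -a_j a_{j+1}$.
  let ε : ℕ → ℤˣ := fun m => Nat.rec (motive := fun _ => ℤˣ) 1
    (fun m e => -(a (x + 2 * m) * a (x + 2 * m + 1) * e)) m
  have hε : ∀ m : ℕ, p (x + 2 * m) - p (x + 2 * m - 1)
      = ((ε m : ℤ) : GaussianInt) * (p x - p (x - 1)) := by
    intro m
    induction m with
    | zero => simp [ε]
    | succ m ih =>
      have h1 := h.turn (x + 2 * m)
      have h2 := h.turn (x + 2 * m + 1)
      have h3 : ε (m + 1) = -(a (x + 2 * m) * a (x + 2 * m + 1) * ε m) := rfl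
      rw [h3]
      rw [add_sub_cancel_right, h1, ih] at h2
      rw [show x + 2 * ((m + 1 : ℕ) : ℤ) = x + 2 * m + 1 + 1 by push_cast; ring,
        add_sub_cancel_right, h2]
      push_cast
      linear_combination ((a (x + 2 * m) : ℤ) : GaussianInt) * ((a (x + 2 * m + 1) : ℤ) :
        GaussianInt) * ((ε m : ℤ) : GaussianInt) * (p x - p (x - 1)) * imUnit_mul_self
  have hg' : ∀ i j, (i - g) % 2 = 0 → j = i + 2 → a j = -a i := by
    rintro i _ hi rfl
    have := hg ((i - g) / 2)
    convert this using 3 <;> omega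
  obtain ⟨m, hm, hm'⟩ : ∃ m : ℕ, a (x + 2 * m) = a (x + 2 * (0 : ℕ)) ∧ ε m = -1 := by
    refine Paperfolding.exists_reversal (u := fun m => a (x + 2 * m))
      (w := fun m => a (x + 2 * m + 1)) rfl (fun m => rfl) ?_
    rcases Int.emod_two_eq_zero_or_one (x - g) with h0 | h0
    · refine Or.inl ⟨fun k => hg' _ _ (by omega) (by omega), ?_⟩
      · convert h'.altFold ((x - g) / 2) using 3
        omega
    · refine Or.inr ⟨fun k => hg' _ _ (by omega) (by omega), ?_⟩
      · convert h'.altFold ((x - g) / 2) using 3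
        omega
  refine ⟨2 * m, by omega, by simpa using hm, ?_⟩
  rw [hε, hm']
  simp

/-- Every block of a complete folding sequence occurs again at an even distance, traversed in the
opposite direction. -/
theorem IsWalk.exists_reversed_window (L : ℕ) {a : ℤ → ℤˣ} {p : ℤ → GaussianInt} (h : IsWalk a p)
    (ha : IsCompleteFolding a) (x : ℤ) :
    ∃ s : ℤ, s % 2 = 0 ∧ (∀ i, x ≤ i → i < x + L → a (i + s) = a i) ∧
      p (x + s) - p (x + s - 1) = -(p x - p (x - 1)) := by
  induction L using Nat.strong_induction_on generalizing a p x with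
  | _ L ih =>
  -- The derived window has length `(L + 1) / 2`, which is smaller than `L` only for `L ≥ 2`;
  -- windows of length at most 1 are treated directly.
  rcases Nat.lt_or_ge L 2 with hL | hL
  · obtain ⟨s, hs, hs', hs''⟩ := h.exists_reversal ha x
    refine ⟨s, hs, fun i hi hi' => ?_, hs''⟩
    obtain rfl : i = x := by omega
    exact hs'
  obtain ⟨g, hg, ha'⟩ := ha.decomp
  obtain ⟨q, hq, -, hpq⟩ := h.derive hg
  -- Evenness of the derived displacement `t` is what restores the alternating terms: `2 * t` is
  -- then a multiple of their period 4.
  have hg' : ∀ t : ℤ, t % 2 = 0 → ∀ i, (i - g) % 2 = 0 → a (i + 2 * t) = a i := by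
    intro t ht i hi
    have h1 := alternates_pow hg ((i - g) / 2)
    have h2 := alternates_pow hg ((i - g) / 2 + t)
    rw [show g + 2 * ((i - g) / 2) = i by omega] at h1
    rw [show g + 2 * ((i - g) / 2 + t) = i + 2 * t by omega, zpow_add,
      (Int.even_iff.mpr ht).neg_one_zpow, mul_one] at h2
    rw [h1, h2]
  set y := (x - g) / 2 with hy
  obtain ⟨t, ht, ht', ht''⟩ := ih ((L + 1) / 2) (by omega) hq ha' y
  refine ⟨2 * t, by omega, fun i hi hi' => ?_, ?_⟩
  · rcases Int.emod_two_eq_zero_or_one (i - g) with h0 | h0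
    · exact hg' t ht i h0
    · have := ht' ((i - g - 1) / 2) (by omega) (by omega)
      convert this using 2 <;> omega
  · have h1 := hpq y
    have h2 := hpq (y + t)
    have h3 := hg' t ht (g + 2 * y) (by omega)
    rw [show g + 2 * (y + t) = g + 2 * y + 2 * t by ring, h3, ht''] at h2
    have h4 : p (g + 2 * y + 2 * t) - p (g + 2 * y + 2 * t - 1) =
        -(p (g + 2 * y) - p (g + 2 * y - 1)) := by
      rcases h1 with ⟨h1, h1'⟩ | ⟨h1, h1'⟩ <;> rcases h2 with ⟨h2, h2'⟩ | ⟨h2, h2'⟩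
      · rw [h1', h2']
      · exact absurd (h1.symm.trans h2) (by decide)
      · exact absurd (h1.symm.trans h2) (by decide)
      · rw [h1', h2']; ring
    clear_value y
    rcases Int.emod_two_eq_zero_or_one (x - g) with h0 | h0
    · obtain rfl : x = g + 2 * y := by omega
      exact h4
    · obtain rfl : x = g + 2 * y + 1 := by omega
      have h5 := h.turn (g + 2 * y)
      have h6 := h.turn (g + 2 * y + 2 * t)
      rw [h3, h4] at h6
      rw [add_sub_cancel_right, h5, add_right_comm, add_sub_cancel_right, h6]
      ring

/-! ### Edges traversed by a walk -/

/-- The edge with endpoints `z`, `w` is traversed by the walk `p`, in one direction or the other. -/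
def Edge (p : ℤ → GaussianInt) (z w : GaussianInt) : Prop :=
  ∃ j, (p (j - 1) = z ∧ p j = w) ∨ (p (j - 1) = w ∧ p j = z)

lemma Edge.symm {p : ℤ → GaussianInt} {z w : GaussianInt} (h : Edge p z w) : Edge p w z := by
  obtain ⟨j, h⟩ := h
  exact ⟨j, h.symm⟩

/-- The four edges at `z` are traversed by `p`. -/
def Full (p : ℤ → GaussianInt) (z : GaussianInt) : Prop := ∀ u, IsDir u → Edge p z (z + u)

/-- A walk associated to a complete folding sequence. -/
def IsFoldingWalk (p : ℤ → GaussianInt) : Prop := ∃ a, IsCompleteFolding a ∧ IsWalk a p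

/-- `1` on one colour of the chessboard, and `i` on the other one. -/
def chess (σ : ℤ) (z : GaussianInt) : GaussianInt := if (coordSum z + σ) % 2 = 0 then 1 else 𝐢

lemma chess_eq (σ : ℤ) (z : GaussianInt) : chess σ z = 1 ∨ chess σ z = 𝐢 := by
  unfold chess; split_ifs <;> simp

/-- `p` is obtained from `q` by unfolding the edges: at each vertex the four edges are turned
by the same angle, `± π / 4`. -/
def Unfolds (q p : ℤ → GaussianInt) (z₀ : GaussianInt) (σ : ℤ) : Prop :=
  ∀ z u, IsDir u → Edge q z (z + u) →
    Edge p (z₀ + (1 + 𝐢) * z) (z₀ + (1 + 𝐢) * z + chess σ z * u)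

theorem IsFoldingWalk.exists_unfolds {p : ℤ → GaussianInt} (h : IsFoldingWalk p) :
    ∃ q z₀ σ, IsFoldingWalk q ∧ Unfolds q p z₀ σ := by
  obtain ⟨a, ha, hp⟩ := h
  obtain ⟨g, hg, ha'⟩ := ha.decomp
  obtain ⟨q, hq, hpq, hd⟩ := hp.derive hg
  -- The rotation at an outgoing end of a derived edge is determined by `a (g + 2 * k)`, which
  -- alternates with `k`, as does the chessboard colour of `q k`. Hence it depends only on the
  -- colour of the vertex, and `σ` calibrates this dependence at `q 0`. The incoming end has the
  -- other colour and the other rotation.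
  have hI := imUnit_mul_self
  refine ⟨q, p (g + 1), (if a g = 1 then 1 else 0) - coordSum (q 0), ⟨_, ha', hq⟩, ?_⟩
  have hs : ∀ k, (k + (if a g = 1 then 0 else 1)) % 2 = 0 ↔ a (g + 2 * k) = 1 := by
    intro k
    rw [alternates_pow hg]
    rcases Int.even_or_odd k with hk | hk
    · rw [hk.neg_one_zpow]
      rcases Int.units_eq_one_or (a g) with h1 | h1 <;> simp [h1] <;> grind
    · rw [hk.neg_one_zpow]
      rcases Int.units_eq_one_or (a g) with h1 | h1 <;> simp [h1] <;> grind
  rintro z u hu ⟨j, ⟨h1, h2⟩ | ⟨h1, h2⟩⟩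
  · have hc : chess ((if a g = 1 then 1 else 0) - coordSum (q 0)) z
        = if a (g + 2 * j) = 1 then 1 else 𝐢 := by
      unfold chess
      congr 1
      rw [← hs, ← h1, eq_iff_iff]
      have := hq.coordSum_mod (j - 1)
      split_ifs <;> omega
    have h3 := hpq (j - 1)
    rw [h1, show g + 1 + 2 * (j - 1) = g + 2 * j - 1 by ring] at h3
    refine ⟨g + 2 * j, Or.inl ⟨h3, ?_⟩⟩
    rw [hc, ← h3]
    rcases hd j with ⟨h4, h5⟩ | ⟨h4, h5⟩ <;> rw [h4] <;> rw [h1, h2] at h5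
    · simp; linear_combination h5
    · rw [if_neg (by decide)]; linear_combination h5
  · have hc : chess ((if a g = 1 then 1 else 0) - coordSum (q 0)) z
        = if a (g + 2 * j) = 1 then 𝐢 else 1 := by
      have hx : ∀ P Q : Prop, ∀ [Decidable P] [Decidable Q], (P ↔ ¬ Q) →
          (if P then (1 : GaussianInt) else 𝐢) = if Q then 𝐢 else 1 := by
        intro P Q _ _ hPQ
        by_cases hQ : Q <;> simp [hQ, hPQ]
      unfold chess
      refine hx _ _ ?_
      rw [← hs, ← h2]
      have := hq.coordSum_mod j
      split_ifs <;> omega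
    have h3 := hpq j
    have h6 := hpq (j - 1)
    rw [h2] at h3
    rw [h1, show g + 1 + 2 * (j - 1) = g + 2 * j - 1 by ring] at h6
    refine ⟨g + 1 + 2 * j, Or.inr ⟨?_, h3⟩⟩
    rw [hc, show g + 1 + 2 * j - 1 = g + 2 * j by ring]
    rcases hd j with ⟨h4, h5⟩ | ⟨h4, h5⟩ <;> rw [h4] <;> rw [h1, h2] at h5
    · simp; linear_combination h5 + h6
    · rw [if_neg (by decide)]; linear_combination h5 + h6

lemma Unfolds.full {q p : ℤ → GaussianInt} {z₀ z : GaussianInt} {σ : ℤ} (h : Unfolds q p z₀ σ)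
    (hz : Full q z) : Full p (z₀ + (1 + 𝐢) * z) := by
  intro v hv
  have hI := imUnit_mul_self
  rcases chess_eq σ z with hc | hc
  · have := h z v hv (hz v hv)
    rwa [hc, one_mul] at this
  · have hv' := hv.imUnit_mul.neg
    have := h z _ hv' (hz _ hv')
    rw [hc] at this
    convert this using 2
    linear_combination v * hI

/-- The new vertex is the image of the centre of the unit square with opposite corners `z` and `z +
(1 + 𝐢) * u`. These two corners being full, all four sides of the square are traversed. -/
lemma Unfolds.full_center {q p : ℤ → GaussianInt} {z₀ z u : GaussianInt} {σ : ℤ}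
    (h : Unfolds q p z₀ σ) (hu : IsDir u) (hz : Full q z) (hz' : Full q (z + (1 + 𝐢) * u)) :
    Full p (z₀ + (1 + 𝐢) * z + 𝐢 * u) := by
  have hI := imUnit_mul_self
  -- At a corner of the square, one of its two sides unfolds to the edge pointing to the centre;
  -- which one depends on the colour of the corner.
  have corner : ∀ w v, IsDir v → Edge q w (w + v) → Edge q w (w - 𝐢 * v) →
      Edge p (z₀ + (1 + 𝐢) * w + v) (z₀ + (1 + 𝐢) * w) := by
    intro w v hv h1 h2
    rcases chess_eq σ w with hc | hc
    · have := h w v hv h1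
      rw [hc, one_mul] at this
      exact this.symm
    · have := h w (-(𝐢 * v)) hv.imUnit_mul.neg (by rwa [← sub_eq_add_neg])
      rw [hc] at this
      convert this.symm using 2
      linear_combination v * hI
  have e1 := corner z (𝐢 * u) hu.imUnit_mul (hz _ hu.imUnit_mul) (by
    convert hz u hu using 1; linear_combination -u * hI)
  have e2 := corner (z + (1 + 𝐢) * u) (-(𝐢 * u)) hu.imUnit_mul.neg (hz' _ hu.imUnit_mul.neg) (by
    convert hz' _ hu.neg using 1; linear_combination u * hI)
  have e3 := corner (z + u) (-u) hu.neg (by convert (hz u hu).symm using 1; ring) (by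
    convert (hz' _ hu.imUnit_mul.neg).symm using 1 <;> ring)
  have e4 := corner (z + 𝐢 * u) u hu (by
    convert (hz' _ hu.neg).symm using 1 <;> ring) (by
    convert (hz _ hu.imUnit_mul).symm using 1; ring)
  have hcases : ∀ v, IsDir v → v = -(𝐢 * u) ∨ v = 𝐢 * u ∨ v = u ∨ v = -u := by
    intro v hv
    rcases hu with rfl | rfl | rfl | rfl <;> rcases hv with rfl | rfl | rfl | rfl <;> decide
  intro v hv
  rcases hcases v hv with rfl | rfl | rfl | rfl
  · convert e1 using 1; ring
  · convert e2 using 1 <;> linear_combination -u * hI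
  · convert e3 using 1 <;> ring
  · convert e4 using 1 <;> linear_combination -u * hI

/-! ### Large boxes all of whose edges belong to one walk -/

/-- The vertices `z + (s + t i) u` with `s, t ≥ 0` and `s + t ≤ n` are full. -/
def FullTriangle (p : ℤ → GaussianInt) (n : ℕ) (z u : GaussianInt) : Prop :=
  ∀ s t : ℤ, 0 ≤ s → 0 ≤ t → s + t ≤ n → Full p (z + ((s : GaussianInt) + t * 𝐢) * u)

/-- Since $(1+i)^2 = 2i$, two unfoldings double the triangle and turn it by a right angle. Old
vertices give the even-even places and centres of squares give the others. Such a centre needs only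
two opposite corners, so a triangle suffices where the whole square is not available. -/
lemma FullTriangle.unfold {r q p : ℤ → GaussianInt} {n : ℕ} {z u z₀ z₁ : GaussianInt} {σ τ : ℤ}
    (h : FullTriangle r n z u) (hu : IsDir u) (hr : Unfolds r q z₀ σ) (hq : Unfolds q p z₁ τ) :
    FullTriangle p (2 * n) (z₁ + (1 + 𝐢) * (z₀ + (1 + 𝐢) * z)) (𝐢 * u) := by
  have hI := imUnit_mul_self
  have hu' := hu.imUnit_mul
  intro s t hs ht hst
  push_cast at hst
  have key : ∀ x y : ℤ, 0 ≤ x → 0 ≤ y → x + y ≤ n →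
      Full q (z₀ + (1 + 𝐢) * (z + ((x : GaussianInt) + y * 𝐢) * u)) := fun x y hx hy hxy =>
    hr.full (h x y hx hy hxy)
  obtain ⟨x, rfl | rfl⟩ : ∃ x, s = 2 * x ∨ s = 2 * x + 1 := ⟨s / 2, by omega⟩ <;>
    obtain ⟨y, rfl | rfl⟩ : ∃ y, t = 2 * y ∨ t = 2 * y + 1 := ⟨t / 2, by omega⟩ <;> push_cast
  · convert hq.full (key x y (by omega) (by omega) (by omega)) using 1
    linear_combination (-((x : GaussianInt) + y * 𝐢) * u) * hI
  · convert hq.full_center hu'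
      (key x y (by omega) (by omega) (by omega)) (by
        convert key x (y + 1) (by omega) (by omega) (by omega) using 1; push_cast; ring) using 1
    linear_combination (-((x : GaussianInt) + y * 𝐢) * u) * hI
  · convert hq.full_center hu (key x y (by omega) (by omega) (by omega)) (by
        convert key (x + 1) y (by omega) (by omega) (by omega) using 1; push_cast; ring) using 1
    linear_combination (-((x : GaussianInt) + y * 𝐢) * u) * hI
  -- The odd-odd places are centres created by the first unfolding, using the antidiagonal corners;
  -- the mixed ones are created by the second.
  · have hc := hr.full_center hu' (h (x + 1) y (by omega) (by omega) (by omega)) (by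
      convert h x (y + 1) (by omega) (by omega) (by omega) using 1
      push_cast; linear_combination u * hI)
    convert hq.full hc using 1
    push_cast
    linear_combination (-((x : GaussianInt) + y * 𝐢) * u - (u + 𝐢 * u)) * hI

/-! ### Existence of a first full triangle -/

/-- The edges `(z, z + u)`, for `(z, u)` in `l`, belong to `p` up to a similarity. -/
def CoversEdges (p : ℤ → GaussianInt) (z v : GaussianInt)
    (l : List (GaussianInt × GaussianInt)) : Prop :=
  ∀ e ∈ l, IsDir e.2 ∧ Edge p (z + v * e.1) (z + v * (e.1 + e.2))

/-- The edges obtained by unfolding those of `l`. -/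
def unfoldEdges (σ : ℤ) (l : List (GaussianInt × GaussianInt)) :
    List (GaussianInt × GaussianInt) :=
  l.flatMap fun e => [((1 + 𝐢) * e.1, chess σ e.1 * e.2),
    ((1 + 𝐢) * (e.1 + e.2), chess σ (e.1 + e.2) * -e.2)]

lemma chess_congr {σ τ : ℤ} {z w : GaussianInt}
    (h : (coordSum z + σ - (coordSum w + τ)) % 2 = 0) : chess σ z = chess τ w := by
  unfold chess
  congr 1
  rw [eq_iff_iff]
  omega

lemma isDir_chess_mul (σ : ℤ) (z : GaussianInt) {u : GaussianInt} (hu : IsDir u) :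
    IsDir (chess σ z * u) := by
  rcases chess_eq σ z with h | h <;> rw [h]
  · rwa [one_mul]
  · exact hu.imUnit_mul

/-- Multiplication by a unit preserves chessboard colours, so relative to the base vertex an
unfolding has only two possibilities, given by the parity of `σ + coordSum z`. This is why a binary
tree covers all cases. -/
lemma Unfolds.coversEdges {q p : ℤ → GaussianInt} {z₀ z v : GaussianInt} {σ : ℤ}
    {l : List (GaussianInt × GaussianInt)} (h : Unfolds q p z₀ σ) (hv : IsDir v)
    (hl : CoversEdges q z v l) :
    CoversEdges p (z₀ + (1 + 𝐢) * z) v (unfoldEdges ((σ + coordSum z) % 2) l) := by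
  have key : ∀ w u, IsDir u → Edge q (z + v * w) (z + v * (w + u)) →
      Edge p (z₀ + (1 + 𝐢) * z + v * ((1 + 𝐢) * w)) (z₀ + (1 + 𝐢) * z + v * ((1 + 𝐢) * w +
        chess ((σ + coordSum z) % 2) w * u)) := by
    intro w u hu he
    have h1 := h (z + v * w) (v * u) (hv.mul hu) (by convert he using 1; ring)
    rw [chess_congr (σ := σ) (τ := (σ + coordSum z) % 2) (w := w)] at h1
    · convert h1 using 1 <;> ring
    · have := coordSum_dir_mul hv w
      rw [coordSum_add]
      omega
  intro e he
  simp only [unfoldEdges, List.mem_flatMap, List.mem_cons, List.not_mem_nil, or_false] at he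
  obtain ⟨⟨w, u⟩, hm, rfl | rfl⟩ := he
  · exact ⟨isDir_chess_mul _ _ (hl _ hm).1, key _ _ (hl _ hm).1 (hl _ hm).2⟩
  · refine ⟨isDir_chess_mul _ _ (hl _ hm).1.neg, key _ _ (hl _ hm).1.neg ?_⟩
    rw [add_neg_cancel_right]
    exact (hl _ hm).2.symm

/-- The four edges at `z` are in `l`. -/
def fullIn (l : List (GaussianInt × GaussianInt)) (z : GaussianInt) : Bool :=
  [1, -1, 𝐢, -𝐢].all fun u => l.any fun e => e = (z, u) || e = (z + u, -u)

lemma CoversEdges.full {p : ℤ → GaussianInt} {z v w : GaussianInt}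
    {l : List (GaussianInt × GaussianInt)} (h : CoversEdges p z v l) (hv : IsDir v)
    (hw : fullIn l w = true) : Full p (z + v * w) := by
  have key : ∀ u, IsDir u → Edge p (z + v * w) (z + v * (w + u)) := by
    intro u hu
    have hmem : u ∈ [1, -1, 𝐢, -𝐢] := by simpa [IsDir] using hu
    have h1 := List.all_eq_true.mp hw u hmem
    obtain ⟨e, he, he'⟩ := List.any_eq_true.mp h1
    simp only [Bool.or_eq_true, decide_eq_true_eq] at he'
    rcases he' with rfl | rfl
    · exact (h _ he).2
    · have := (h _ he).2.symm
      rwa [add_neg_cancel_right] at this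
  intro d hd
  obtain ⟨u, hu, rfl⟩ : ∃ u, IsDir u ∧ v * u = d := by
    have hI := imUnit_mul_self
    rcases hv with rfl | rfl | rfl | rfl
    · exact ⟨d, hd, one_mul d⟩
    · exact ⟨-d, hd.neg, by ring⟩
    · exact ⟨-(𝐢 * d), hd.imUnit_mul.neg, by linear_combination -d * hI⟩
    · exact ⟨𝐢 * d, hd.imUnit_mul, by linear_combination -d * hI⟩
  convert key u hu using 1
  ring

lemma FullTriangle.of_corners {p : ℤ → GaussianInt} {z u : GaussianInt} (h0 : Full p z)
    (h1 : Full p (z + u)) (h2 : Full p (z + 𝐢 * u)) : FullTriangle p 1 z u := by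
  intro s t hs ht hst
  obtain ⟨rfl, rfl⟩ | ⟨rfl, rfl⟩ | ⟨rfl, rfl⟩ : (s = 0 ∧ t = 0) ∨ (s = 1 ∧ t = 0) ∨
      (s = 0 ∧ t = 1) := by omega
  · simpa using h0
  · simpa using h1
  · simpa using h2

/-- Some triangle with sides of length `1` is full. -/
def HasFullTriangle (p : ℤ → GaussianInt) : Prop :=
  ∃ z u, IsDir u ∧ FullTriangle p 1 z u

/-- A unit triangle survives one unfolding: the image of its right-angled corner, that of one other
corner, and the centre of its square form another. Leaves of unequal depth can thus be compared at a
common depth. -/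
lemma HasFullTriangle.unfold {q p : ℤ → GaussianInt} {z₀ : GaussianInt} {σ : ℤ}
    (h : HasFullTriangle q) (hq : Unfolds q p z₀ σ) : HasFullTriangle p := by
  obtain ⟨z, u, hu, h⟩ := h
  have hI := imUnit_mul_self
  have e0 := h 0 0 le_rfl le_rfl (by simp)
  have e1 := h 1 0 (by simp) le_rfl (by simp)
  have e2 := h 0 1 le_rfl (by simp) (by simp)
  simp only [Int.cast_zero, Int.cast_one, zero_mul, one_mul, add_zero, zero_add] at e0 e1 e2
  refine ⟨z₀ + (1 + 𝐢) * z + 𝐢 * u, -(𝐢 * u), hu.imUnit_mul.neg, .of_corners ?_ ?_ ?_⟩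
  · convert hq.full_center hu.imUnit_mul e1 (by
      convert e2 using 1; linear_combination u * hI) using 1
    linear_combination -u * hI
  · convert hq.full e0 using 1; ring
  · convert hq.full e1 using 1; linear_combination -u * hI

/-- A witness that a set of edges yields a full triangle however it is unfolded. -/
inductive TriangleTree
  | leaf (z u : GaussianInt)
  | node (s t : TriangleTree)

namespace TriangleTree

/-- The number of unfoldings which are considered. -/
def depth : TriangleTree → ℕ
  | leaf _ _ => 0
  | node s t => max s.depth t.depth + 1

/-- The leaves of the tree are full triangles. -/
def check : TriangleTree → List (GaussianInt × GaussianInt) → Bool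
  | leaf z u, l => decide (u ∈ [1, -1, 𝐢, -𝐢]) && fullIn l z && fullIn l (z + u) &&
      fullIn l (z + 𝐢 * u)
  | node s t, l => s.check (unfoldEdges 0 l) && t.check (unfoldEdges 1 l)

/-- A tree for the set which consists of a single edge. -/
def single : TriangleTree :=
  .node (.node (.node (.node (.node (.leaf ⟨-3, -1⟩ (-1)) (.leaf ⟨-3, -1⟩ 𝐢)) (.node (.leaf
    ⟨-1, 1⟩ 𝐢) (.node (.leaf ⟨-3, 1⟩ (-1)) (.leaf ⟨-2, 1⟩ (-1))))) (.node (.leaf ⟨-1, 1⟩ 𝐢)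
    (.node (.leaf ⟨-3, 1⟩ (-1)) (.leaf ⟨-2, 1⟩ (-1))))) (.node (.node (.node (.leaf ⟨-5, -2⟩
    1) (.leaf ⟨-5, -1⟩ 1)) (.leaf ⟨-3, 1⟩ 1)) (.node (.node (.node (.leaf ⟨-2, -9⟩ 𝐢) (.leaf
    ⟨1, -3⟩ 𝐢)) (.leaf ⟨-5, -3⟩ 𝐢)) (.node (.leaf ⟨-3, -1⟩ 𝐢) (.leaf ⟨-3, -1⟩ 1))))) (.node
    (.node (.node (.node (.leaf ⟨-1, -3⟩ 1) (.leaf ⟨-1, -3⟩ (-𝐢))) (.node (.leaf ⟨-3, -5⟩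
    (-𝐢)) (.node (.leaf ⟨2, -9⟩ 1) (.leaf ⟨2, -9⟩ 1)))) (.node (.leaf ⟨-3, -1⟩ (-𝐢)) (.node
    (.leaf ⟨-2, -5⟩ 1) (.leaf ⟨-2, -5⟩ 1)))) (.node (.node (.node (.leaf ⟨1, -2⟩ (-1)) (.leaf
    ⟨1, -3⟩ 𝐢)) (.leaf ⟨-1, -1⟩ (-1))) (.node (.node (.node (.leaf ⟨2, 1⟩ (-𝐢)) (.leaf ⟨2, 0⟩
    1)) (.leaf ⟨-3, -3⟩ 1)) (.node (.leaf ⟨-1, -3⟩ (-𝐢)) (.leaf ⟨-1, -3⟩ (-1))))))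

lemma check_single : single.check [(0, 1)] = true := by decide +kernel

end TriangleTree

/-- `p` is obtained from `q` by `n` unfoldings. -/
def UnfoldsIter : ℕ → (ℤ → GaussianInt) → (ℤ → GaussianInt) → Prop
  | 0, q, p => q = p
  | n + 1, q, p => ∃ r z σ, Unfolds q r z σ ∧ UnfoldsIter n r p

lemma UnfoldsIter.snoc {n : ℕ} {q r p : ℤ → GaussianInt} {z : GaussianInt} {σ : ℤ}
    (h : UnfoldsIter n q r) (h' : Unfolds r p z σ) : UnfoldsIter (n + 1) q p := by
  induction n generalizing q with
  | zero =>
    obtain rfl : q = r := h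
    exact ⟨p, z, σ, h', rfl⟩
  | succ n ih =>
    obtain ⟨r', z', σ', h1, h2⟩ := h
    exact ⟨r', z', σ', h1, ih h2⟩

lemma IsFoldingWalk.exists_unfoldsIter {p : ℤ → GaussianInt} (h : IsFoldingWalk p) (n : ℕ) :
    ∃ q, IsFoldingWalk q ∧ UnfoldsIter n q p := by
  induction n generalizing p with
  | zero => exact ⟨p, h, rfl⟩
  | succ n ih =>
    obtain ⟨r, z, σ, hr, h'⟩ := h.exists_unfolds
    obtain ⟨q, hq, hqr⟩ := ih hr
    exact ⟨q, hq, hqr.snoc h'⟩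

lemma HasFullTriangle.unfoldsIter {n : ℕ} {q p : ℤ → GaussianInt} (h : HasFullTriangle q)
    (hq : UnfoldsIter n q p) : HasFullTriangle p := by
  induction n generalizing q with
  | zero => obtain rfl : q = p := hq; exact h
  | succ n ih =>
    obtain ⟨r, z, σ, h1, h2⟩ := hq
    exact ih (h.unfold h1) h2

lemma TriangleTree.hasFullTriangle (T : TriangleTree) {l : List (GaussianInt × GaussianInt)}
    (hT : T.check l = true) {n : ℕ} (hn : T.depth ≤ n) {q p : ℤ → GaussianInt}
    {z v : GaussianInt} (hv : IsDir v) (hl : CoversEdges q z v l) (h : UnfoldsIter n q p) :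
    HasFullTriangle p := by
  induction T generalizing l n q z with
  | leaf w u =>
    simp only [check, Bool.and_eq_true, decide_eq_true_eq] at hT
    obtain ⟨⟨⟨h1, h2⟩, h3⟩, h4⟩ := hT
    have hu : IsDir u := by simpa [IsDir] using h1
    refine HasFullTriangle.unfoldsIter ⟨z + v * w, v * u, hv.mul hu, .of_corners ?_ ?_ ?_⟩ h
    · exact hl.full hv h2
    · convert hl.full hv h3 using 1; ring
    · convert hl.full hv h4 using 1; ring
  | node s t hs ht =>
    simp only [check, Bool.and_eq_true] at hT
    simp only [depth] at hn
    obtain ⟨n, rfl⟩ : ∃ m, n = m + 1 := ⟨n - 1, by omega⟩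
    obtain ⟨r, z', σ, h1, h2⟩ := h
    have h3 := h1.coversEdges hv hl
    rcases Int.emod_two_eq_zero_or_one (σ + coordSum z) with h4 | h4 <;> rw [h4] at h3
    · exact hs hT.1 (by omega) h3 h2
    · exact ht hT.2 (by omega) h3 h2

/-- Fold the walk back by the depth of the tree and start from any one edge: the search succeeds
whatever colours occur on the way forward. -/
lemma IsFoldingWalk.hasFullTriangle {p : ℤ → GaussianInt} (h : IsFoldingWalk p) :
    HasFullTriangle p := by
  obtain ⟨q, ⟨a, -, hq⟩, hqp⟩ := h.exists_unfoldsIter TriangleTree.single.depth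
  refine TriangleTree.single.hasFullTriangle TriangleTree.check_single le_rfl
    (hq.isDir 1) (z := q 0) ?_ hqp
  intro e he
  obtain rfl : e = (0, 1) := by simpa using he
  exact ⟨Or.inl rfl, 1, Or.inl ⟨by simp, by simp⟩⟩

lemma IsFoldingWalk.exists_fullTriangle (j : ℕ) {p : ℤ → GaussianInt} (h : IsFoldingWalk p) :
    ∃ z u, IsDir u ∧ FullTriangle p (2 ^ j) z u := by
  induction j generalizing p with
  | zero => exact h.hasFullTriangle
  | succ j ih =>
    obtain ⟨q, z₁, τ, hq, hqp⟩ := h.exists_unfolds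
    obtain ⟨r, z₀, σ, hr, hrq⟩ := hq.exists_unfolds
    obtain ⟨z, u, hu, hz⟩ := ih hr
    rw [pow_succ']
    exact ⟨_, _, hu.imUnit_mul, hz.unfold hu hrq hqp⟩

/-- There are arbitrarily large boxes all of whose edges belong to a given folding walk. -/
theorem IsFoldingWalk.exists_full_box {p : ℤ → GaussianInt} (h : IsFoldingWalk p) (R : ℕ) :
    ∃ c : GaussianInt, ∀ w : GaussianInt, |w.re - c.re| ≤ R → |w.im - c.im| ≤ R → Full p w := by
  obtain ⟨z, u, hu, hz⟩ := h.exists_fullTriangle (4 * R)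
  have hR : 4 * R < 2 ^ (4 * R) := Nat.lt_two_pow_self
  have hR' : (4 * R : ℤ) < (2 ^ (4 * R) : ℕ) := by exact_mod_cast hR
  generalize 2 ^ (4 * R) = N at hz hR'
  -- The box is centred at offset `(R, R)` in the triangle, so both coordinates stay in `[0, 2R]`
  -- and their sum is at most `4R`.
  have key : ∀ s t : ℤ, |s| ≤ R → |t| ≤ R → Full p (z + ((R : GaussianInt) + R * 𝐢) * u +
      ((s : GaussianInt) + t * 𝐢) * u) := by
    intro s t hs ht
    rw [abs_le] at hs ht
    convert hz (R + s) (R + t) (by omega) (by omega) (by omega) using 1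
    push_cast
    ring
  refine ⟨z + ((R : GaussianInt) + R * 𝐢) * u, fun w h1 h2 => ?_⟩
  generalize z + ((R : GaussianInt) + R * 𝐢) * u = c at *
  rcases hu with rfl | rfl | rfl | rfl
  · convert key (w.re - c.re) (w.im - c.im) h1 h2 using 1
    ext <;> simp [imUnit]
  · convert key (-(w.re - c.re)) (-(w.im - c.im)) (by rwa [abs_neg]) (by rwa [abs_neg]) using 1
    ext <;> simp [imUnit]
  · convert key (w.im - c.im) (-(w.re - c.re)) h2 (by rwa [abs_neg]) using 1
    ext <;> simp [imUnit]
  · convert key (-(w.im - c.im)) (w.re - c.re) (by rwa [abs_neg]) h1 using 1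
    ext <;> simp [imUnit]

/-! ### Segments as oriented edges of the lattice -/

/-- `1` for `true`, `-1` for `false`. -/
def boolSign (b : Bool) : ℤˣ := if b then 1 else -1

namespace Seg

/-- The vertex of the lattice where the oriented support begins. -/
def source (s : Seg) : GaussianInt :=
  if s.fwd then ⟨s.x, s.y⟩ else if s.horiz then ⟨s.x + 1, s.y⟩ else ⟨s.x, s.y + 1⟩

/-- The direction of the oriented support. -/
def step (s : Seg) : GaussianInt := ⟨s.dir.1, s.dir.2⟩

/-- The vertex of the lattice where the oriented support ends. -/
def target (s : Seg) : GaussianInt := s.source + s.step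

/-- The side of the support on which the segment begins. -/
def sourceSign (s : Seg) : ℤˣ := if s.fwd then s.ζ else s.η

/-- The side of the support on which the segment ends. -/
def targetSign (s : Seg) : ℤˣ := if s.fwd then s.η else s.ζ

/-- The image of a segment under a translation of the lattice. -/
def shift (w : ℤ × ℤ) (s : Seg) : Seg := { s with x := s.x + w.1, y := s.y + w.2 }

/-- The support of `t` continues that of `s` at a right angle, and the segments fit together. -/
structure Linked (s t : Seg) : Prop where
  target_eq : s.target = t.source
  horiz_eq : t.horiz = !s.horiz
  targetSign_eq : s.targetSign = boolSign t.fwd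
  sourceSign_eq : t.sourceSign = -boolSign s.fwd

lemma ext_source {s t : Seg} (h1 : s.source = t.source) (h2 : s.horiz = t.horiz)
    (h3 : s.fwd = t.fwd) (h4 : s.sourceSign = t.sourceSign) (h5 : s.targetSign = t.targetSign) :
    s = t := by
  obtain ⟨x, y, horiz, fwd, ζ, η⟩ := s
  obtain ⟨x', y', horiz', fwd', ζ', η'⟩ := t
  simp only at h2 h3
  subst h2 h3
  cases horiz <;> cases fwd <;>
    simp_all [source, sourceSign, targetSign]

lemma isDir_step (s : Seg) : IsDir s.step := by
  obtain ⟨x, y, horiz, fwd, ζ, η⟩ := s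
  cases horiz <;> cases fwd <;> simp [step, dir, IsDir, imUnit] <;> decide

end Seg

lemma sgn_one : sgn 1 = 1 := by simp [sgn]

lemma sgn_neg_one : sgn (-1) = -1 := by simp [sgn]

/-- Since $2\alpha < 1$, the points at distance $\alpha$ from distinct integers are distinct. -/
lemma eq_of_add_sgn_mul {α : ℝ} (hα0 : 0 < α) (hα1 : α < 1 / 4) {m n : ℤ} {o o' : ℤˣ}
    (h : (m : ℝ) + sgn o * α = n + sgn o' * α) : m = n ∧ o = o' := by
  have hmn : m = n := by
    have h1 : (m : ℝ) - n < 1 ∧ (n : ℝ) - m < 1 := by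
      rcases Int.units_eq_one_or o with rfl | rfl <;>
        rcases Int.units_eq_one_or o' with rfl | rfl <;>
        simp only [sgn_one, sgn_neg_one] at h <;> constructor <;> linarith
    have h2 : m - n < 1 := by exact_mod_cast h1.1
    have h3 : n - m < 1 := by exact_mod_cast h1.2
    omega
  subst hmn
  refine ⟨rfl, ?_⟩
  rcases Int.units_eq_one_or o with rfl | rfl <;> rcases Int.units_eq_one_or o' with rfl | rfl <;>
    simp only [sgn_one, sgn_neg_one] at h <;> first | rfl | (exfalso; linarith)

namespace Seg

lemma ending_eq (α : ℝ) (s : Seg) : s.ending α =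
    (s.target.re + sgn (if s.horiz then -boolSign s.fwd else s.targetSign) * α,
      s.target.im + sgn (if s.horiz then s.targetSign else -boolSign s.fwd) * α) := by
  obtain ⟨x, y, horiz, fwd, ζ, η⟩ := s
  cases horiz <;> cases fwd <;>
    simp [ending, target, source, step, dir, targetSign, pt, boolSign, sgn_one, sgn_neg_one] <;>
    ring

lemma beginning_eq (α : ℝ) (s : Seg) : s.beginning α =
    (s.source.re + sgn (if s.horiz then boolSign s.fwd else s.sourceSign) * α,
      s.source.im + sgn (if s.horiz then s.sourceSign else boolSign s.fwd) * α) := by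
  obtain ⟨x, y, horiz, fwd, ζ, η⟩ := s
  cases horiz <;> cases fwd <;>
    simp [beginning, source, sourceSign, pt, boolSign, sgn_one, sgn_neg_one] <;>
    ring

/-- The common point lies at $(\pm\alpha, \pm\alpha)$ from a lattice vertex, so it reveals the
vertex and both signs. Two parallel supports would then be traversed in opposite directions from
that vertex and would coincide; hence the hypothesis on supports. -/
lemma linked_of_ending_eq {α : ℝ} (hα0 : 0 < α) (hα1 : α < 1 / 4) {s t : Seg}
    (h : s.ending α = t.beginning α) (h' : s.support ≠ t.support) : s.Linked t := by
  rw [ending_eq, beginning_eq, Prod.mk.injEq] at h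
  obtain ⟨h1, h2⟩ := eq_of_add_sgn_mul hα0 hα1 h.1
  obtain ⟨h3, h4⟩ := eq_of_add_sgn_mul hα0 hα1 h.2
  have h5 : s.target = t.source := Zsqrtd.ext h1 h3
  obtain ⟨x, y, horiz, fwd, ζ, η⟩ := s
  obtain ⟨x', y', horiz', fwd', ζ', η'⟩ := t
  simp only [support] at h'
  refine ⟨h5, ?_, ?_, ?_⟩ <;>
  cases horiz <;> cases horiz' <;> cases fwd <;> cases fwd' <;>
    simp_all [target, source, step, dir, targetSign, sourceSign, boolSign]

lemma Linked.step_eq {s t : Seg} (h : s.Linked t) :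
    t.step = ((turn s t : ℤ) : GaussianInt) * 𝐢 * s.step := by
  have h1 := h.horiz_eq
  obtain ⟨x, y, horiz, fwd, ζ, η⟩ := s
  obtain ⟨x', y', horiz', fwd', ζ', η'⟩ := t
  simp only at h1
  subst h1
  cases horiz <;> cases fwd <;> cases fwd' <;> simp [step, dir, turn] <;> decide

end Seg

/-! ### Tiles -/

/-- The tile of a segment in coordinates `l` along and `c` across the support, centered at the
middle of the support. -/
def TileShape (α : ℝ) (d e f : ℤˣ) (l c : ℝ) : Prop :=
  (|l| + |c| ≤ 1 / 2 ∨ (|sgn d * l - (1 / 2 - α)| ≤ α ∧ |c - sgn f * α| ≤ α)) ∧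
    ¬ (|sgn d * l + (1 / 2 - α)| < α ∧ |c - sgn e * α| < α)

section TileShape

variable {α : ℝ} {d e f : ℤˣ} {l c : ℝ}

lemma TileShape.bound (hα1 : α < 1 / 4) (h : TileShape α d e f l c) :
    |l| ≤ 1 / 2 ∧ |c| ≤ 1 / 2 := by
  rcases h.1 with h | ⟨h1, h2⟩
  · have := abs_nonneg l
    have := abs_nonneg c
    constructor <;> linarith
  · rw [abs_le] at h1 h2 ⊢
    rw [abs_le]
    rcases Int.units_eq_one_or d with rfl | rfl <;> rcases Int.units_eq_one_or f with rfl | rfl <;>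
      simp only [sgn_one, sgn_neg_one] at h1 h2 <;> refine ⟨⟨?_, ?_⟩, ?_, ?_⟩ <;> linarith

lemma tileShape_along (hα0 : 0 < α) (u : ℤˣ) :
    TileShape α d e f (sgn u / 2) 0 := by
  refine ⟨Or.inl ?_, fun h => ?_⟩
  · rcases Int.units_eq_one_or u with rfl | rfl <;> simp [sgn_one, sgn_neg_one, abs_div]
  · have := h.2
    rcases Int.units_eq_one_or e with rfl | rfl <;>
      simp [sgn_one, sgn_neg_one, abs_of_pos hα0] at this

lemma tileShape_across (hα1 : α < 1 / 4) (u : ℤˣ) :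
    TileShape α d e f 0 (sgn u / 2) := by
  refine ⟨Or.inl ?_, fun h => ?_⟩
  · rcases Int.units_eq_one_or u with rfl | rfl <;> simp [sgn_one, sgn_neg_one, abs_div]
  · have := h.1
    rw [mul_zero, abs_lt] at this
    linarith

/-- The outer corner of the bump lies outside the diamond, so it identifies the final end and its
side. -/
lemma tileShape_bump (hα0 : 0 < α) (hα1 : α < 1 / 4) :
    TileShape α d e f (sgn d / 2) (sgn f * (2 * α)) := by
  refine ⟨Or.inr ?_, fun h => ?_⟩
  · rw [abs_le, abs_le]
    rcases Int.units_eq_one_or d with rfl | rfl <;> rcases Int.units_eq_one_or f with rfl | rfl <;>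
      simp only [sgn_one, sgn_neg_one] <;> refine ⟨⟨?_, ?_⟩, ?_, ?_⟩ <;> linarith
  · have := h.1
    rw [abs_lt] at this
    rcases Int.units_eq_one_or d with rfl | rfl <;>
      simp only [sgn_one, sgn_neg_one] at this <;> linarith

lemma TileShape.eq_of_bump {d' f' : ℤˣ} (hα0 : 0 < α) (hα1 : α < 1 / 4)
    (h : TileShape α d e f (sgn d' / 2) (sgn f' * (2 * α))) : d = d' ∧ f = f' := by
  have hs : ∀ u : ℤˣ, |sgn u| = 1 := fun u => by
    rcases Int.units_eq_one_or u with rfl | rfl <;> simp [sgn_one, sgn_neg_one]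
  rcases h.1 with h | ⟨h1, h2⟩
  · rw [abs_div, abs_mul, hs, hs, abs_of_pos (by positivity : (0 : ℝ) < 2 * α),
      abs_of_pos (by norm_num : (0 : ℝ) < 2)] at h
    linarith
  · rw [abs_le] at h1 h2
    rcases Int.units_eq_one_or d with rfl | rfl <;> rcases Int.units_eq_one_or f with rfl | rfl <;>
      rcases Int.units_eq_one_or d' with rfl | rfl <;>
      rcases Int.units_eq_one_or f' with rfl | rfl <;>
      simp only [sgn_one, sgn_neg_one] at h1 h2 <;> first | exact ⟨rfl, rfl⟩ | (exfalso; linarith)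

lemma not_tileShape_bump_swap {d' f' : ℤˣ} (hα0 : 0 < α) (hα1 : α < 1 / 4) :
    ¬ TileShape α d e f (sgn f' * (2 * α)) (sgn d' / 2) := by
  intro h
  have hs : ∀ u : ℤˣ, |sgn u| = 1 := fun u => by
    rcases Int.units_eq_one_or u with rfl | rfl <;> simp [sgn_one, sgn_neg_one]
  rcases h.1 with h | ⟨h1, h2⟩
  · rw [abs_div, abs_mul, hs, hs, abs_of_pos (by positivity : (0 : ℝ) < 2 * α),
      abs_of_pos (by norm_num : (0 : ℝ) < 2)] at h
    linarith
  · rw [abs_le] at h2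
    rcases Int.units_eq_one_or f with rfl | rfl <;>
      rcases Int.units_eq_one_or d' with rfl | rfl <;>
      simp only [sgn_one, sgn_neg_one] at h2 <;> linarith

/-- The two possible dent centres lie on the boundary of the diamond; exactly the one actually
removed is missing, which identifies the initial sign. -/
lemma tileShape_dent_iff {e' : ℤˣ} (hα0 : 0 < α) (hα1 : α < 1 / 4) :
    TileShape α d e f (-sgn d * (1 / 2 - α)) (sgn e' * α) ↔ e' ≠ e := by
  have hs : ∀ u : ℤˣ, |sgn u| = 1 := fun u => by
    rcases Int.units_eq_one_or u with rfl | rfl <;> simp [sgn_one, sgn_neg_one]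
  have hd : sgn d * sgn d = 1 := by
    rcases Int.units_eq_one_or d with rfl | rfl <;> simp [sgn_one, sgn_neg_one]
  constructor
  · rintro h rfl
    refine h.2 ⟨?_, by simpa⟩
    rw [show sgn d * (-sgn d * (1 / 2 - α)) + (1 / 2 - α) =
      (1 - sgn d * sgn d) * (1 / 2 - α) by ring, hd]
    simpa
  · intro h
    refine ⟨Or.inl ?_, fun h' => ?_⟩
    · rw [abs_mul, abs_mul, abs_neg, hs, hs, abs_of_pos hα0, abs_of_pos (by linarith)]
      linarith
    · have h2 := h'.2
      rw [abs_lt] at h2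
      rcases Int.units_eq_one_or e with rfl | rfl <;>
        rcases Int.units_eq_one_or e' with rfl | rfl <;>
        simp only [sgn_one, sgn_neg_one] at h2 <;> first | exact h rfl | linarith

end TileShape

namespace Seg

/-- The middle of the support. -/
noncomputable def center (s : Seg) : ℝ × ℝ :=
  if s.horiz then (s.x + 1 / 2, s.y) else (s.x, s.y + 1 / 2)

/-- The tile of `s`, in coordinates centered at the middle of the support. -/
def shape (α : ℝ) (s : Seg) (q : ℝ × ℝ) : Prop :=
  TileShape α (boolSign s.fwd) s.sourceSign s.targetSign (if s.horiz then q.1 else q.2)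
    (if s.horiz then q.2 else q.1)

lemma mem_tile {α : ℝ} {s : Seg} {p : ℝ × ℝ} : p ∈ s.tile α ↔ s.shape α (p - s.center) := by
  obtain ⟨x, y, horiz, fwd, ζ, η⟩ := s
  obtain ⟨a, b⟩ := p
  have key : ∀ t u r : ℝ, t = u ∨ t = -u → (|t| ≤ r ↔ |u| ≤ r) ∧ (|t| < r ↔ |u| < r) := by
    intro t u r h
    rw [abs_eq_abs.mpr h]
    simp
  cases horiz <;> cases fwd <;>
    simp only [tile, shape, TileShape, center, along, across, boolSign, sourceSign, targetSign,
      Set.mem_sdiff, Set.mem_union, Set.mem_ofPred_eq, max_le_iff, max_lt_iff, sgn_one, sgn_neg_one,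
      if_true, if_false, Bool.false_eq_true, Prod.fst_sub, Prod.snd_sub, one_mul]
  all_goals
    refine and_congr (or_congr ?_ (and_congr (key _ _ _ ?_).1 (key _ _ _ ?_).1))
      (not_congr (and_congr (key _ _ _ ?_).2 (key _ _ _ ?_).2))
    · rw [sub_sub]
    all_goals first | (left; ring1) | (right; ring1)

lemma shape.bound {α : ℝ} (hα1 : α < 1 / 4) {s : Seg} {q : ℝ × ℝ} (h : s.shape α q) :
    |q.1| ≤ 1 / 2 ∧ |q.2| ≤ 1 / 2 := by
  unfold shape at h
  split_ifs at h
  · exact TileShape.bound hα1 h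
  · exact (TileShape.bound hα1 h).symm

lemma shape_fst {α : ℝ} (hα0 : 0 < α) (hα1 : α < 1 / 4) (s : Seg) (u : ℤˣ) :
    s.shape α (sgn u / 2, 0) := by
  unfold shape
  split_ifs
  · exact tileShape_along hα0 u
  · exact tileShape_across hα1 u

lemma shape_snd {α : ℝ} (hα0 : 0 < α) (hα1 : α < 1 / 4) (s : Seg) (u : ℤˣ) :
    s.shape α (0, sgn u / 2) := by
  unfold shape
  split_ifs
  · exact tileShape_across hα1 u
  · exact tileShape_along hα0 u

lemma boolSign_injective : Function.Injective boolSign := by decide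

lemma shape_injective {α : ℝ} (hα0 : 0 < α) (hα1 : α < 1 / 4) {s t : Seg}
    (h : ∀ q, s.shape α q ↔ t.shape α q) :
    s.horiz = t.horiz ∧ s.fwd = t.fwd ∧ s.sourceSign = t.sourceSign ∧
      s.targetSign = t.targetSign := by
  have hb := @tileShape_bump α (boolSign s.fwd) s.sourceSign s.targetSign hα0 hα1
  unfold shape at h
  cases hs : s.horiz <;> cases ht : t.horiz <;>
    simp only [hs, ht, if_true, if_false, Bool.false_eq_true] at h
  · have h1 := ((h (_, _)).mp hb).eq_of_bump hα0 hα1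
    obtain ⟨h1, h2⟩ := h1
    have h3 := h (sgn s.sourceSign * α, -sgn (boolSign s.fwd) * (1 / 2 - α))
    rw [tileShape_dent_iff hα0 hα1, ← h1, tileShape_dent_iff hα0 hα1] at h3
    exact ⟨rfl, boolSign_injective h1.symm, by simpa using h3, h2.symm⟩
  · exact absurd ((h (_, _)).mp hb) (not_tileShape_bump_swap hα0 hα1)
  · exact absurd ((h (_, _)).mp hb) (not_tileShape_bump_swap hα0 hα1)
  · have h1 := ((h (_, _)).mp hb).eq_of_bump hα0 hα1
    obtain ⟨h1, h2⟩ := h1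
    have h3 := h (-sgn (boolSign s.fwd) * (1 / 2 - α), sgn s.sourceSign * α)
    rw [tileShape_dent_iff hα0 hα1, ← h1, tileShape_dent_iff hα0 hα1] at h3
    exact ⟨rfl, boolSign_injective h1.symm, by simpa using h3, h2.symm⟩

/-- A lattice vector as a vector of the plane. -/
def _root_.Paperfolding.castVec (w : ℤ × ℤ) : ℝ × ℝ := (w.1, w.2)

lemma center_shift (w : ℤ × ℤ) (s : Seg) : (s.shift w).center = castVec w + s.center := by
  unfold center shift castVec
  split_ifs <;> ext <;> simp <;> ring

lemma tile_shift (α : ℝ) (w : ℤ × ℤ) (s : Seg) :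
    (s.shift w).tile α = (fun p => castVec w + p) '' s.tile α := by
  ext p
  rw [Set.image_add_left, Set.mem_preimage, mem_tile, mem_tile, center_shift]
  rw [show -castVec w + p - s.center = p - (castVec w + s.center) by abel]
  rfl

/-- If a translate of a tile is a tile, then the translation is one of the lattice and the
corresponding segments are translates of each other. -/
theorem eq_shift_of_tile_eq {α : ℝ} (hα0 : 0 < α) (hα1 : α < 1 / 4) {s t : Seg} {v : ℝ × ℝ}
    (h : (fun p => v + p) '' s.tile α = t.tile α) : ∃ w, v = castVec w ∧ t = s.shift w := by
  have h1 : ∀ q, s.shape α q ↔ t.shape α (v + s.center - t.center + q) := by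
    intro q
    have : q + s.center ∈ s.tile α ↔ v + (q + s.center) ∈ t.tile α := by
      rw [← h, Set.image_add_left, Set.mem_preimage, neg_add_cancel_left]
    rw [mem_tile, mem_tile, add_sub_cancel_right] at this
    rw [this, show v + (q + s.center) - t.center = v + s.center - t.center + q by abel]
  -- Each tile contains the midpoints of the four sides of the unit square around its centre and
  -- stays inside that square, so the centre is determined by the tile.
  have h2 : v + s.center - t.center = 0 := by
    generalize v + s.center - t.center = δ at h1
    have f1 := ((h1 _).mp (s.shape_fst hα0 hα1 1)).bound hα1
    have f2 := ((h1 _).mp (s.shape_fst hα0 hα1 (-1))).bound hα1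
    have f3 := ((h1 _).mp (s.shape_snd hα0 hα1 1)).bound hα1
    have f4 := ((h1 _).mp (s.shape_snd hα0 hα1 (-1))).bound hα1
    simp only [Prod.fst_add, Prod.snd_add, sgn_one, sgn_neg_one, abs_le] at f1 f2 f3 f4
    ext <;> simp only [Prod.fst_zero, Prod.snd_zero] <;> linarith
  simp only [h2, zero_add] at h1
  obtain ⟨h3, h4, h5, h6⟩ := shape_injective hα0 hα1 h1
  obtain ⟨x, y, horiz, fwd, ζ, η⟩ := s
  obtain ⟨x', y', horiz', fwd', ζ', η'⟩ := t
  simp only at h3 h4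
  subst h3 h4
  refine ⟨(x' - x, y' - y), ?_, ?_⟩
  · rw [sub_eq_zero, ← eq_sub_iff_add_eq] at h2
    rw [h2]
    unfold center castVec
    cases horiz <;> ext <;> simp
  · cases fwd <;> simp_all [shift, sourceSign, targetSign]

end Seg

/-! ### The walk of a complete folding curve -/

namespace Seg

lemma source_shift (w : ℤ × ℤ) (s : Seg) : (s.shift w).source = ⟨w.1, w.2⟩ + s.source := by
  unfold source shift
  simp only
  split_ifs <;> ext <;> simp <;> ring

lemma Linked.shift {s t : Seg} (h : s.Linked t) (w : ℤ × ℤ) :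
    (s.shift w).Linked (t.shift w) := by
  refine ⟨?_, h.horiz_eq, h.targetSign_eq, h.sourceSign_eq⟩
  have : (s.shift w).target = (s.shift w).source + s.step := rfl
  rw [this, source_shift, source_shift, ← h.target_eq, add_assoc]
  rfl

lemma support_eq_of_source {s t : Seg} (h1 : s.source = t.source) (h2 : s.horiz = t.horiz)
    (h3 : s.fwd = t.fwd) : s.support = t.support := by
  obtain ⟨x, y, horiz, fwd, ζ, η⟩ := s
  obtain ⟨x', y', horiz', fwd', ζ', η'⟩ := t
  simp only at h2 h3
  subst h2 h3
  cases horiz <;> cases fwd <;> simp_all [source, support]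

/-- The side on which a segment ends already encodes the direction of its successor. A segment
therefore fixes the next support, which lets indices be matched along a curve. -/
lemma Linked.support_eq {s t t' : Seg} (h : s.Linked t) (h' : s.Linked t') :
    t.support = t'.support :=
  support_eq_of_source (h.target_eq.symm.trans h'.target_eq) (h.horiz_eq.trans h'.horiz_eq.symm)
    (boolSign_injective (h.targetSign_eq.symm.trans h'.targetSign_eq))

lemma eq_of_step_eq {s t : Seg} (h : s.step = t.step) : s.horiz = t.horiz ∧ s.fwd = t.fwd := by
  obtain ⟨x, y, horiz, fwd, ζ, η⟩ := s
  obtain ⟨x', y', horiz', fwd', ζ', η'⟩ := t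
  cases horiz <;> cases fwd <;> cases horiz' <;> cases fwd' <;> simp_all [step, dir]

lemma step_eq_or_neg {s t : Seg} (h : s.horiz = t.horiz) : s.step = t.step ∨ s.step = -t.step := by
  obtain ⟨x, y, horiz, fwd, ζ, η⟩ := s
  obtain ⟨x', y', horiz', fwd', ζ', η'⟩ := t
  simp only at h
  subst h
  cases horiz <;> cases fwd <;> cases fwd' <;> simp [step, dir] <;> decide

/-- The edge from `(x, y)` to its right or upper neighbour is the support of `s` if `s` traverses
it in one of the two directions. -/
lemma eq_of_source_target {s : Seg} {x y : ℤ} {horiz : Bool}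
    (h : (s.source = ⟨x, y⟩ ∧ s.target = ⟨x, y⟩ + if horiz then 1 else 𝐢) ∨
      (s.source = ⟨x, y⟩ + (if horiz then 1 else 𝐢) ∧ s.target = ⟨x, y⟩)) :
    s.x = x ∧ s.y = y ∧ s.horiz = horiz := by
  obtain ⟨x', y', horiz', fwd', ζ', η'⟩ := s
  rcases h with ⟨h1, h2⟩ | ⟨h1, h2⟩ <;> cases horiz <;> cases horiz' <;> cases fwd' <;>
    simp [target, source, step, dir, imUnit, Zsqrtd.ext_iff] at h1 h2 ⊢ <;> omega

end Seg

section Curve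

variable {α : ℝ} {C D : ℤ → Seg}

lemma IsCompleteCurve.linked (hα0 : 0 < α) (hα1 : α < 1 / 4) (h : IsCompleteCurve α C) (i : ℤ) :
    (C i).Linked (C (i + 1)) :=
  Seg.linked_of_ending_eq hα0 hα1 (h.1 i).2 fun h' => by
    have := h.2 h'
    omega

/-- The segments of `C` are linked, and have distinct supports. -/
structure IsLinkedCurve (C : ℤ → Seg) : Prop where
  linked : ∀ i, (C i).Linked (C (i + 1))
  injective : Function.Injective fun i => (C i).support
  folding : IsCompleteFolding (turnSeq C)

lemma IsCompleteFoldingCurve.isLinkedCurve (hα0 : 0 < α) (hα1 : α < 1 / 4)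
    (h : IsCompleteFoldingCurve α C) : IsLinkedCurve C :=
  ⟨h.1.linked hα0 hα1, h.1.2, h.2⟩

namespace IsLinkedCurve

lemma target_pred (h : IsLinkedCurve C) (j : ℤ) : (C (j - 1)).target = (C j).source := by
  have := (h.linked (j - 1)).target_eq
  rwa [sub_add_cancel] at this

lemma target_sub (h : IsLinkedCurve C) (j : ℤ) :
    (C j).target - (C (j - 1)).target = (C j).step := by
  rw [h.target_pred, Seg.target, add_sub_cancel_left]

lemma isWalk (h : IsLinkedCurve C) : IsWalk (turnSeq C) fun j => (C j).target where
  isDir j := by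
    rw [h.target_sub]
    exact (C j).isDir_step
  turn j := by
    have := h.target_sub (j + 1)
    rw [add_sub_cancel_right] at this
    rw [h.target_sub, this]
    exact (h.linked j).step_eq

lemma isFoldingWalk (h : IsLinkedCurve C) : IsFoldingWalk fun j => (C j).target :=
  ⟨_, h.folding, h.isWalk⟩

lemma exists_of_full (h : IsLinkedCurve C) {x y : ℤ}
    (hf : Full (fun j => (C j).target) ⟨x, y⟩) (horiz : Bool) :
    ∃ j, (C j).x = x ∧ (C j).y = y ∧ (C j).horiz = horiz := by
  obtain ⟨j, hj⟩ := hf (if horiz then 1 else 𝐢) (by cases horiz <;> simp [IsDir])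
  simp only [h.target_pred] at hj
  exact ⟨j, Seg.eq_of_source_target hj⟩

lemma horiz_add (h : IsLinkedCurve C) {i j : ℤ} (hij : (i - j) % 2 = 0) :
    (C i).horiz = (C j).horiz := by
  have step : ∀ i, (C (i + 2)).horiz = (C i).horiz := fun i => by
    have h1 := (h.linked i).horiz_eq
    have h2 := (h.linked (i + 1)).horiz_eq
    rw [add_assoc] at h2
    rw [show (2 : ℤ) = 1 + 1 by rfl, h2, h1, Bool.not_not]
  obtain ⟨m, hm⟩ : ∃ m, i = j + 2 * m := ⟨(i - j) / 2, by omega⟩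
  rw [hm]
  clear hm hij
  induction m using Int.induction_on with
  | zero => simp
  | succ n ih =>
    rw [← ih, ← step (j + 2 * n)]
    congr 2
    ring
  | pred n ih =>
    rw [← ih, ← step]
    congr 2
    ring

lemma sameType_iff (hC : IsLinkedCurve C) (hD : IsLinkedCurve D) {g r : ℤ}
    (hg : E 1 (turnSeq C) = {i | ∃ m : ℤ, i = g + 1 + 2 * m})
    (hr : E 1 (turnSeq D) = {i | ∃ m : ℤ, i = r + 1 + 2 * m}) :
    SameType C D ↔ (C (g + 1)).horiz = (D (r + 1)).horiz := by
  have key : ∀ {C : ℤ → Seg} {g : ℤ}, IsLinkedCurve C →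
      E 1 (turnSeq C) = {i | ∃ m : ℤ, i = g + 1 + 2 * m} →
      ∀ b, (∀ i ∈ E 1 (turnSeq C), (C i).horiz = b) ↔ (C (g + 1)).horiz = b := by
    intro C g hC hg b
    rw [hg]
    constructor
    · intro h
      exact h _ ⟨0, by simp⟩
    · rintro h i ⟨m, rfl⟩
      rw [← h]
      exact hC.horiz_add (by omega)
  unfold SameType IsTypeH IsTypeV
  rw [key hC hg, key hC hg, key hD hr, key hD hr]
  cases (C (g + 1)).horiz <;> cases (D (r + 1)).horiz <;> simp

/-- If translates of consecutive segments of `C` are segments of `D`, then they are consecutive in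
`D`. -/
lemma exists_shift_index (hC : IsLinkedCurve C) (hD : IsLinkedCurve D) {w : ℤ × ℤ} {x : ℤ}
    (n : ℕ) (h : ∀ i, x ≤ i → i ≤ x + n → ∃ j, D j = (C i).shift w) :
    ∃ s, ∀ i, x ≤ i → i ≤ x + n → D (i + s) = (C i).shift w := by
  induction n with
  | zero =>
    obtain ⟨j, hj⟩ := h x le_rfl (by simp)
    refine ⟨j - x, fun i h1 h2 => ?_⟩
    obtain rfl : i = x := by simp at h2; omega
    rwa [add_sub_cancel]
  | succ n ih =>
    obtain ⟨s, hs⟩ := ih fun i h1 h2 => h i h1 (by push_cast; omega)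
    obtain ⟨j, hj⟩ := h (x + n + 1) (by omega) (by push_cast; omega)
    have h1 := hs (x + n) (by omega) (by omega)
    have h2 := (hC.linked (x + n)).shift w
    rw [← h1, ← hj] at h2
    have h3 := hD.injective (h2.support_eq (hD.linked (x + n + s)))
    refine ⟨s, fun i h4 h5 => ?_⟩
    push_cast at h5
    rcases eq_or_ne i (x + n + 1) with rfl | h6
    · rw [← hj, h3]
      congr 1
      ring
    · exact hs i h4 (by omega)

/-- For curves of the same type with locally isomorphic sequences, each block of the first one is a
translate of a block of the second one. -/
lemma exists_shift_of_seq (hC : IsLinkedCurve C) (hD : IsLinkedCurve D) (hT : SameType C D)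
    (hS : SeqLocallyIsomorphic (turnSeq C) (turnSeq D)) (N : ℕ) :
    ∃ s w, ∀ i : ℤ, -N ≤ i → i ≤ N → D (i + s) = (C i).shift w := by
  obtain ⟨g, hg, hg'⟩ := hC.folding.decomp
  obtain ⟨r, hr, hr'⟩ := hD.folding.decomp
  rw [sameType_iff hC hD (E_one_eq hg hg') (E_one_eq hr hr')] at hT
  -- The window exceeds `[-N, N]` by a neighbour on each side, needed to recover the end signs, and
  -- is long enough for `parity_unique` even when `N = 0`.
  obtain ⟨L, hL⟩ : ∃ L : ℕ, L = 2 * N + 12 := ⟨_, rfl⟩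
  obtain ⟨x, hx⟩ : ∃ x : ℤ, x = -N - 1 := ⟨_, rfl⟩
  obtain ⟨y, n, hy⟩ := (hS _).mp ⟨x - 1, L, rfl⟩
  obtain rfl : L = n := by simpa [subword_eq] using congrArg List.length hy
  have h0 : ∀ i, x ≤ i → i < x + L → turnSeq D (i + (y + 1 - x)) = turnSeq C i := by
    intro i h1 h2
    have := congrArg (fun l => l[(i - x).toNat]?) hy
    simp only [subword_eq, List.getElem?_map, List.getElem?_range (show (i - x).toNat < L by omega),
      Option.map_some, Option.some.injEq] at this
    convert this.symm using 2 <;> omega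
  have hpar := parity_unique (x := x) hg' hr fun i h1 h2 => h0 i h1 (by omega)
  obtain ⟨s, hs, hs'⟩ : ∃ s, (∀ i, x ≤ i → i < x + L → turnSeq D (i + s) = turnSeq C i) ∧
      (D (x + s)).step = (C x).step := by
    -- Equal types, together with matching $E_1$ parities, make corresponding supports parallel.
    -- Only the sense of traversal may differ, and a reversed recurrence of the block in `D`
    -- corrects it.
    have hh : (D (x + (y + 1 - x))).horiz = (C x).horiz := by
      rcases Int.emod_two_eq_zero_or_one (x - (g + 1)) with h1 | h1
      · rw [hC.horiz_add h1, hT]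
        exact hD.horiz_add (by omega)
      · have h2 := (hC.linked x).horiz_eq
        have h3 := (hD.linked (x + (y + 1 - x))).horiz_eq
        rw [hC.horiz_add (j := g + 1) (by omega), hT, ← hD.horiz_add (i := x + (y + 1 - x) + 1)
          (by omega), h3] at h2
        simpa using h2
    rcases Seg.step_eq_or_neg hh with h1 | h1
    · exact ⟨_, h0, h1⟩
    · obtain ⟨t, -, ht, ht'⟩ := hD.isWalk.exists_reversed_window L hD.folding (x + (y + 1 - x))
      simp only [hD.target_sub] at ht'
      refine ⟨y + 1 - x + t, fun i h2 h3 => ?_, ?_⟩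
      · rw [← h0 i h2 h3, ← ht (i + (y + 1 - x)) (by omega) (by omega)]
        congr 1
        ring
      · rw [← add_assoc, ht', h1, neg_neg]
  have hstep : ∀ k : ℕ, k ≤ L → (D (x + k + s)).step = (C (x + k)).step := by
    intro k
    induction k with
    | zero => simpa using hs'
    | succ k ih =>
      intro hk
      have h1 := (hC.linked (x + k)).step_eq
      have h2 := (hD.linked (x + k + s)).step_eq
      have h3 := hs (x + k) (by omega) (by omega)
      unfold turnSeq at h3
      push_cast
      rw [← add_assoc, h1, ← ih (by omega), ← h3, ← h2]
      congr 2
      ring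
  obtain ⟨w, hw⟩ : ∃ w : ℤ × ℤ, (⟨w.1, w.2⟩ : GaussianInt) = (D (x + s)).source - (C x).source :=
    ⟨(_, _), rfl⟩
  have hsource : ∀ k : ℕ, k ≤ L → (D (x + k + s)).source = ⟨w.1, w.2⟩ + (C (x + k)).source := by
    intro k
    induction k with
    | zero => simp [hw]
    | succ k ih =>
      intro hk
      have h1 := (hC.linked (x + k)).target_eq
      have h2 := (hD.linked (x + k + s)).target_eq
      rw [Seg.target, ih (by omega), hstep k (by omega), add_assoc, ← Seg.target, h1] at h2
      push_cast
      rw [← add_assoc, h2]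
      congr 2
      ring
  refine ⟨s, w, fun i h1 h2 => ?_⟩
  -- Positions and directions agree on the enlarged window. The initial sign of a segment is then
  -- read from its predecessor and the final sign from its successor.
  obtain ⟨k, rfl⟩ : ∃ k : ℕ, i = x + (k + 1 : ℕ) := ⟨(i - x - 1).toNat, by omega⟩
  have e0 := Seg.eq_of_step_eq (hstep k (by omega))
  have e1 := Seg.eq_of_step_eq (hstep (k + 1) (by omega))
  have e2 := Seg.eq_of_step_eq (hstep (k + 1 + 1) (by omega))
  have c1 := hC.linked (x + k)
  have c2 := hC.linked (x + (k + 1 : ℕ))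
  have d1 := hD.linked (x + k + s)
  have d2 := hD.linked (x + (k + 1 : ℕ) + s)
  rw [show x + (k : ℤ) + 1 = x + (k + 1 : ℕ) by push_cast; ring] at c1
  rw [show x + ((k + 1 : ℕ) : ℤ) + 1 = x + (k + 1 + 1 : ℕ) by push_cast; ring] at c2
  rw [show x + (k : ℤ) + s + 1 = x + (k + 1 : ℕ) + s by push_cast; ring] at d1
  rw [show x + ((k + 1 : ℕ) : ℤ) + s + 1 = x + (k + 1 + 1 : ℕ) + s by push_cast; ring] at d2
  refine Seg.ext_source ?_ e1.1 e1.2 ?_ ?_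
  · rw [Seg.source_shift, hsource _ (by omega)]
  · exact (d1.sourceSign_eq.trans (by rw [e0.2])).trans c1.sourceSign_eq.symm
  · exact (d2.targetSign_eq.trans (by rw [e2.2])).trans c2.targetSign_eq.symm

end IsLinkedCurve

end Curve

/-! ### Patches of the tilings -/

lemma translate_translate (v w : ℝ × ℝ) (F : Set (Set (ℝ × ℝ))) :
    translate v (translate w F) = translate (v + w) F := by
  unfold translate
  rw [Set.image_image]
  congr 1
  ext P : 1
  rw [Set.image_image]
  simp only [add_assoc]

lemma translate_zero (F : Set (Set (ℝ × ℝ))) : translate 0 F = F := by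
  simp [translate]

lemma sUnion_translate (v : ℝ × ℝ) (F : Set (Set (ℝ × ℝ))) :
    ⋃₀ translate v F = (fun p => v + p) '' ⋃₀ F := by
  rw [translate, Set.sUnion_image, Set.image_sUnion]
  simp [Set.sUnion_image]

lemma isBounded_sUnion_translate (v : ℝ × ℝ) {F : Set (Set (ℝ × ℝ))}
    (h : Bornology.IsBounded (⋃₀ F)) : Bornology.IsBounded (⋃₀ translate v F) := by
  rw [sUnion_translate]
  exact (isometry_add_left v).lipschitz.isBounded_image h

lemma abs_le_of_mem_disk {c p : ℝ × ℝ} {r : ℝ} (hr : 0 < r) (h : p ∈ disk c r) :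
    |p.1 - c.1| ≤ r ∧ |p.2 - c.2| ≤ r := by
  have h' : (p.1 - c.1) ^ 2 + (p.2 - c.2) ^ 2 ≤ r ^ 2 := h
  constructor <;> refine abs_le_of_sq_le_sq ?_ hr.le <;>
    nlinarith [sq_nonneg (p.1 - c.1), sq_nonneg (p.2 - c.2)]

namespace Seg

variable {α : ℝ}

/-- A point of the tile which is near the lower or left end of the support. -/
lemma exists_mem_tile (hα0 : 0 < α) (hα1 : α < 1 / 4) (s : Seg) :
    ∃ p ∈ s.tile α, |p.1 - s.x| ≤ 1 ∧ |p.2 - s.y| ≤ 1 := by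
  refine ⟨(sgn 1 / 2, 0) + s.center, ?_, ?_⟩
  · rw [mem_tile, add_sub_cancel_right]
    exact s.shape_fst hα0 hα1 1
  · unfold center
    split_ifs <;> simp only [sgn_one, Prod.fst_add, Prod.snd_add, abs_le] <;>
      refine ⟨⟨?_, ?_⟩, ?_, ?_⟩ <;> linarith

lemma isBounded_tile (hα1 : α < 1 / 4) (s : Seg) : Bornology.IsBounded (s.tile α) := by
  refine (Metric.isBounded_closedBall (x := s.center) (r := 1 / 2)).subset fun p hp => ?_
  rw [mem_tile] at hp
  have := hp.bound hα1
  rw [Metric.mem_closedBall, Prod.dist_eq, Real.dist_eq, Real.dist_eq]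
  exact max_le this.1 this.2

end Seg

/-! ### Comparing patches of a covering with blocks of one curve -/

section Main

variable {α : ℝ} {K 𝒞 𝒟 : Set (ℤ → Seg)} {C D : ℤ → Seg}

/-- By the local isomorphism property, each bounded patch appears inside any given curve. -/
theorem exists_translate_subset_curve (hα0 : 0 < α) (hα1 : α < 1 / 4)
    (hK : IsCoveringByCurves α K) (lK : LocalIsomorphismProperty (tiling α K)) (hD : D ∈ K)
    {F : Set (Set (ℝ × ℝ))} (hF : Bornology.IsBounded (⋃₀ F)) {v : ℝ × ℝ}
    (hv : translate v F ⊆ tiling α K) :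
    ∃ w, translate w F ⊆ Seg.tile α '' Set.range D := by
  have hD' := (hK.1 D hD).isLinkedCurve hα0 hα1
  obtain ⟨r, hr, hr'⟩ := lK _ ⟨hv, isBounded_sUnion_translate v hF⟩
  -- The extra 1 allows for the distance from a point of a tile to the lower or left end of its
  -- support.
  obtain ⟨c, hc⟩ := hD'.isFoldingWalk.exists_full_box (⌈r⌉₊ + 1)
  obtain ⟨v', h1, h2⟩ := hr' (c.re, c.im)
  rw [translate_translate] at h1 h2
  refine ⟨v' + v, fun P hP => ?_⟩
  obtain ⟨t, ht, rfl⟩ := h1 hP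
  obtain ⟨p, hp, hp1, hp2⟩ := t.exists_mem_tile hα0 hα1
  have h3 := abs_le_of_mem_disk hr (h2 ⟨_, hP, hp⟩)
  have hr2 := Nat.le_ceil r
  have bound : ∀ (a b : ℤ) (q : ℝ), |q - a| ≤ 1 → |q - b| ≤ r →
      |a - b| ≤ ((⌈r⌉₊ + 1 : ℕ) : ℤ) := by
    intro a b q h h'
    rw [abs_le] at h h' ⊢
    constructor
    · have : -((⌈r⌉₊ + 1 : ℕ) : ℝ) ≤ (a : ℝ) - b := by push_cast; linarith
      exact_mod_cast this
    · have : (a : ℝ) - b ≤ ((⌈r⌉₊ + 1 : ℕ) : ℝ) := by push_cast; linarith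
      exact_mod_cast this
  obtain ⟨j, hx, hy, hh⟩ := hD'.exists_of_full (hc ⟨t.x, t.y⟩ (bound _ _ _ hp1 h3.1)
    (bound _ _ _ hp2 h3.2)) t.horiz
  refine ⟨t, ⟨j, ?_⟩, rfl⟩
  -- The curve traverses this support, and the covering has only one segment there.
  obtain ⟨u, -, hu⟩ := hK.2.2.1 t.x t.y t.horiz
  rw [hu t ⟨ht, rfl⟩]
  refine hu (D j) ⟨⟨D, hD, j, rfl⟩, ?_⟩
  rw [Seg.support, hx, hy, hh]

/-- If the bounded patches of `𝒞` appear in `𝒟`, then the blocks of any curve of `𝒞` appear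
in any curve of `𝒟`. -/
theorem exists_shift_of_patches (hα0 : 0 < α) (hα1 : α < 1 / 4)
    (h𝒞 : IsCoveringByCurves α 𝒞) (h𝒟 : IsCoveringByCurves α 𝒟)
    (l𝒟 : LocalIsomorphismProperty (tiling α 𝒟))
    (h : ∀ F, IsBoundedPatch (tiling α 𝒞) F → ∃ v, translate v F ⊆ tiling α 𝒟)
    (hC : C ∈ 𝒞) (hD : D ∈ 𝒟) (x : ℤ) (n : ℕ) :
    ∃ s w, ∀ i, x ≤ i → i ≤ x + n → D (i + s) = (C i).shift w := by
  have hC' := (h𝒞.1 C hC).isLinkedCurve hα0 hα1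
  have hD' := (h𝒟.1 D hD).isLinkedCurve hα0 hα1
  have hb : Bornology.IsBounded (⋃₀ (Seg.tile α '' (C '' Set.Icc x (x + n)))) := by
    rw [Set.image_image, Set.sUnion_image]
    exact (Bornology.isBounded_biUnion (Set.finite_Icc _ _)).mpr fun i _ => (C i).isBounded_tile hα1
  obtain ⟨v, hv⟩ := h _ ⟨Set.image_mono (by rintro _ ⟨i, -, rfl⟩; exact ⟨C, hC, i, rfl⟩), hb⟩
  obtain ⟨w, hw⟩ := exists_translate_subset_curve hα0 hα1 h𝒟 l𝒟 hD hb hv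
  have key : ∀ i, x ≤ i → i ≤ x + n → ∃ z j, w = castVec z ∧ D j = (C i).shift z := by
    intro i h1 h2
    obtain ⟨_, ⟨j, rfl⟩, hj⟩ := hw ⟨_, ⟨_, ⟨i, ⟨h1, h2⟩, rfl⟩, rfl⟩, rfl⟩
    obtain ⟨z, hz, hz'⟩ := Seg.eq_shift_of_tile_eq hα0 hα1 hj.symm
    exact ⟨z, j, hz, hz'⟩
  obtain ⟨z, -, hz, -⟩ := key x le_rfl (by simp)
  obtain ⟨s, hs⟩ := hC'.exists_shift_index hD' (w := z) (x := x) n fun i h1 h2 => by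
    obtain ⟨z', j, hz', hj⟩ := key i h1 h2
    have : z' = z := by
      rw [hz] at hz'
      simp only [castVec, Prod.mk.injEq, Int.cast_inj] at hz'
      exact Prod.ext hz'.1.symm hz'.2.symm
    exact ⟨j, this ▸ hj⟩
  exact ⟨s, z, hs⟩

lemma isSubword_of_shift (h : ∀ (x : ℤ) (n : ℕ), ∃ s w, ∀ i, x ≤ i → i ≤ x + n →
    D (i + s) = (C i).shift w) {u : List ℤˣ} (hu : IsSubword u (turnSeq C)) :
    IsSubword u (turnSeq D) := by
  obtain ⟨x, n, rfl⟩ := hu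
  obtain ⟨s, w, hs⟩ := h (x + 1) n
  refine ⟨x + s, n, ?_⟩
  rw [subword_eq, subword_eq]
  refine List.map_congr_left fun k hk => ?_
  rw [List.mem_range] at hk
  unfold turnSeq
  have h1 := hs (x + 1 + k) (by omega) (by omega)
  have h2 := hs (x + 1 + k + 1) (by omega) (by omega)
  rw [show x + s + 1 + (k : ℤ) = x + 1 + k + s by ring,
    show x + 1 + (k : ℤ) + s + 1 = x + 1 + k + 1 + s by ring, h1, h2]
  rfl

/-- One translated block with nine turns matches the $E_1$ parities of the two curves, and
translation preserves horizontality. -/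
lemma IsLinkedCurve.sameType_of_shift (hC : IsLinkedCurve C) (hD : IsLinkedCurve D)
    (h : ∀ (x : ℤ) (n : ℕ), ∃ s w, ∀ i, x ≤ i → i ≤ x + n → D (i + s) = (C i).shift w) :
    SameType C D := by
  obtain ⟨g, hg, hg'⟩ := hC.folding.decomp
  obtain ⟨r, hr, hr'⟩ := hD.folding.decomp
  rw [sameType_iff hC hD (E_one_eq hg hg') (E_one_eq hr hr')]
  obtain ⟨s, w, hs⟩ := h (g + 1) 10
  have hpar := parity_unique (x := g + 1) (s := s) hg' hr fun i h1 h2 => by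
    unfold turnSeq
    rw [add_right_comm, hs i h1 (by push_cast; omega), hs (i + 1) (by omega) (by push_cast; omega)]
    rfl
  rw [← hD.horiz_add (i := g + 1 + s) (by omega), hs (g + 1) le_rfl (by simp)]
  rfl

lemma IsCoveringByCurves.nonempty (h : IsCoveringByCurves α K) : ∃ C, C ∈ K := by
  obtain ⟨s, ⟨⟨C, hC, -⟩, -⟩, -⟩ := h.2.2.1 0 0 true
  exact ⟨C, hC⟩

/-- Only finitely many tiles of a curve are contained in a given bounded set. -/
lemma IsLinkedCurve.exists_index_bound (hα0 : 0 < α) (hα1 : α < 1 / 4) (hC : IsLinkedCurve C)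
    {B : Set (ℝ × ℝ)} (hB : Bornology.IsBounded B) :
    ∃ N : ℕ, ∀ i, (C i).tile α ⊆ B → -N ≤ i ∧ i ≤ N := by
  obtain ⟨r, hr⟩ := hB.subset_closedBall 0
  obtain ⟨M, hM⟩ := exists_nat_ge (r + 1)
  have hfin : {i | (C i).tile α ⊆ B}.Finite := by
    refine Set.Finite.of_injOn (f := fun i => ((C i).x, (C i).y, (C i).horiz))
      (t := Set.Icc (-M : ℤ) M ×ˢ Set.Icc (-M : ℤ) M ×ˢ Set.univ) ?_ ?_
      ((Set.finite_Icc _ _).prod ((Set.finite_Icc _ _).prod Set.finite_univ))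
    · intro i hi
      obtain ⟨p, hp, h1, h2⟩ := (C i).exists_mem_tile hα0 hα1
      have h3 := hr (hi hp)
      rw [Metric.mem_closedBall, Prod.dist_eq, max_le_iff, Real.dist_eq, Real.dist_eq] at h3
      simp only [Prod.fst_zero, Prod.snd_zero, sub_zero] at h3
      obtain ⟨h3, h4⟩ := h3
      rw [abs_le] at h1 h2 h3 h4
      refine ⟨⟨?_, ?_⟩, ⟨?_, ?_⟩, trivial⟩
      · have : -(M : ℝ) ≤ (C i).x := by linarith
        exact_mod_cast this
      · have : ((C i).x : ℝ) ≤ M := by linarith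
        exact_mod_cast this
      · have : -(M : ℝ) ≤ (C i).y := by linarith
        exact_mod_cast this
      · have : ((C i).y : ℝ) ≤ M := by linarith
        exact_mod_cast this
    · intro i _ j _ hij
      simp only [Prod.mk.injEq] at hij
      apply hC.injective
      simp only [Seg.support, hij.1, hij.2.1, hij.2.2]
  obtain ⟨N, hN⟩ := (hfin.image Int.natAbs).bddAbove
  refine ⟨N, fun i hi => ?_⟩
  have := hN ⟨i, hi, rfl⟩
  omega

/-- If the curves of `𝒞` and `𝒟` have the same type and locally isomorphic sequences, then the
bounded patches of `𝒞` appear in `𝒟`. -/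
theorem exists_translate_of_curves (hα0 : 0 < α) (hα1 : α < 1 / 4)
    (h𝒞 : IsCoveringByCurves α 𝒞) (h𝒟 : IsCoveringByCurves α 𝒟)
    (l𝒞 : LocalIsomorphismProperty (tiling α 𝒞))
    (h : ∀ C ∈ 𝒞, ∀ D ∈ 𝒟, SameType C D ∧ SeqLocallyIsomorphic (turnSeq C) (turnSeq D))
    {F : Set (Set (ℝ × ℝ))} (hF : IsBoundedPatch (tiling α 𝒞) F) :
    ∃ v, translate v F ⊆ tiling α 𝒟 := by
  obtain ⟨C, hC⟩ := h𝒞.nonempty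
  obtain ⟨D, hD⟩ := h𝒟.nonempty
  have hC' := (h𝒞.1 C hC).isLinkedCurve hα0 hα1
  have hD' := (h𝒟.1 D hD).isLinkedCurve hα0 hα1
  -- The patch is first moved inside the single curve `C`. Its tiles then occupy a bounded range of
  -- indices, and the corresponding block can be translated into `D`.
  obtain ⟨w, hw⟩ := exists_translate_subset_curve hα0 hα1 h𝒞 l𝒞 hC hF.2 (v := 0)
    (by rw [translate_zero]; exact hF.1)
  obtain ⟨N, hN⟩ := hC'.exists_index_bound hα0 hα1 (isBounded_sUnion_translate w hF.2)
  obtain ⟨s, z, hs⟩ := hC'.exists_shift_of_seq hD' (h C hC D hD).1 (h C hC D hD).2 N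
  refine ⟨castVec z + w, ?_⟩
  rw [← translate_translate]
  rintro _ ⟨P, hP, rfl⟩
  obtain ⟨_, ⟨i, rfl⟩, rfl⟩ := hw hP
  have hi := hN i (Set.subset_sUnion_of_mem hP)
  exact ⟨D (i + s), ⟨D, hD, _, rfl⟩, by rw [hs i hi.1 hi.2, Seg.tile_shift]⟩

lemma SameType.symm (h : SameType C D) : SameType D C :=
  h.imp And.symm And.symm

end Main

end Paperfolding

theorem theorem3p2 (α : ℝ) (hα0 : 0 < α) (hα1 : α < 1 / 4)
    (𝒞 𝒟 : Set (ℤ → Paperfolding.Seg))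
    (h𝒞 : Paperfolding.IsCoveringByCurves α 𝒞)
    (h𝒟 : Paperfolding.IsCoveringByCurves α 𝒟)
    (l𝒞 : Paperfolding.LocalIsomorphismProperty (Paperfolding.tiling α 𝒞))
    (l𝒟 : Paperfolding.LocalIsomorphismProperty (Paperfolding.tiling α 𝒟)) :
    Paperfolding.LocallyIsomorphic (Paperfolding.tiling α 𝒞) (Paperfolding.tiling α 𝒟) ↔
      ∀ C ∈ 𝒞, ∀ D ∈ 𝒟, Paperfolding.SameType C D ∧
        Paperfolding.SeqLocallyIsomorphic (Paperfolding.turnSeq C) (Paperfolding.turnSeq D) := by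
  open Paperfolding in
  constructor
  · rintro ⟨h1, h2⟩ C hC D hD
    have k1 := exists_shift_of_patches hα0 hα1 h𝒞 h𝒟 l𝒟 h1 hC hD
    have k2 := exists_shift_of_patches hα0 hα1 h𝒟 h𝒞 l𝒞 h2 hD hC
    exact ⟨((h𝒞.1 C hC).isLinkedCurve hα0 hα1).sameType_of_shift
      ((h𝒟.1 D hD).isLinkedCurve hα0 hα1) k1,
      fun u => ⟨isSubword_of_shift k1, isSubword_of_shift k2⟩⟩
  · intro h
    exact ⟨fun F hF => exists_translate_of_curves hα0 hα1 h𝒞 h𝒟 l𝒞 h hF,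
      fun F hF => exists_translate_of_curves hα0 hα1 h𝒟 h𝒞 l𝒟
        (fun D hD C hC => ⟨(h C hC D hD).1.symm, fun u => ((h C hC D hD).2 u).symm⟩) hF⟩
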